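/- For a tuple $A=(A_1,A_2)$ of real symmetric $d\times d$ matrices let $\mathcal D_A=\bigcup_n \mathcal D_A(n)$ be the free spectrahedron, where $\mathcal D_A(n)$ is the set of pairs $X=(X_1,X_2)$ of real symmetric $n\times n$ matrices with $I_{dn}+A_1\otimes X_1+A_2\otimes X_2\succeq 0$. Call $\mathcal D_A$ a free quadrilateral if $\mathcal D_A(1)\subset\mathbb R^2$ is a bounded (nondegenerate) quadrilateral and $\mathcal D_A=\mathcal D_B$ for some pair $B$ of real diagonal $4\times 4$ matrices. A matrix convex combination of tuples $Y^i$ of size $n_i$ ($1\le i\le k$) is a tuple $\sum_{i=1}^k V_i^T Y^i V_i$ of size $n$, with real $n_i\times n$ matrices $V_i$ such that $\sum_{i=1}^k V_i^TV_i=I_n$; the matrix convex hull $\operatorname{co}^{\mathrm{mat}}(E)$ is the set of all matrix convex combinations of elements of $E$. Tuples $X,Y$ of the same size are unitarily equivalent if $U^TXU=Y$ for some real orthogonal $U$. An element $X\in\mathcal D_A(n)$ is - a *free extreme point* of $\mathcal D_A$ if, whenever $X=\sum_i V_i^TY^iV_i$ is a matrix convex combination of $Y^i\in\mathcal D_A(n_i)$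 with all $V_i\ne0$, then for each $i$ either $n_i=n$ and $X$ is unitarily equivalent to $Y^i$, or $n_i>n$ and $X\oplus Z^i$ is unitarily equivalent to $Y^i$ for some $Z^i\in\mathcal D_A$; - an *Arveson extreme point* of $\mathcal D_A$ if $\begin{pmatrix}X&\beta\\ \beta^T&\gamma\end{pmatrix}\in\mathcal D_A$ implies $\beta=0$. **Proposition.** Let $\mathcal D_A$ be a free quadrilateral. If $X\in\mathcal D_A(n)$ is a free extreme point of $\mathcal D_A$, then $n\le 2$. Moreover $\mathcal D_A$ is the matrix convex hull of the set of its Arveson extreme points of size $2$: $$\mathcal D_A=\operatorname{co}^{\mathrm{mat}}\big((\partial^{\mathrm{Arv}}\mathcal D_A)(2)\big),$$ where $(\partial^{\mathrm{Arv}}\mathcal D_A)(2)$ is the set of Arveson extreme points of $\mathcal D_A$ that lie in $\mathcal D_A(2)$. -/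

import Mathlib

open scoped Kronecker

/-- A `g`-tuple of real `n × n` matrices. Symmetry is imposed by the sets below. -/
abbrev MatTuple (g n : ℕ) : Type := Fin g → Matrix (Fin n) (Fin n) ℝ

/-- A dimension-free set `K` of `g`-tuples of square matrices, given by its levels
`K n` (the elements of `K` of size `n`). Level `0` is harmless: the only `0 × 0` tuple is
the empty one. -/
abbrev FreeSet (g : ℕ) : Type := ∀ n : ℕ, Set (MatTuple g n)

namespace FreeSet

/-- The part of `K` of size `m`, again as a dimension-free set. -/
def atLevel {g : ℕ} (K : FreeSet g) (m : ℕ) : FreeSet g :=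
  fun n => {X | n = m ∧ X ∈ K n}

/-- The evaluation `L_A(X) = I + A₁ ⊗ X₁ + ⋯ + A_g ⊗ X_g` of the monic linear pencil. -/
def monicPencil {g d n : ℕ} (A : MatTuple g d) (X : MatTuple g n) :
    Matrix (Fin d × Fin n) (Fin d × Fin n) ℝ :=
  1 + ∑ j, A j ⊗ₖ X j

/-- The free spectrahedron `D_A`: symmetric tuples `X` of all sizes with `L_A(X) ⪰ 0`. -/
def freeSpectrahedron {g d : ℕ} (A : MatTuple g d) : FreeSet g :=
  fun _ => {X | (∀ j, (X j).IsSymm) ∧ (monicPencil A X).PosSemidef}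

/-- `X = ∑ i, V_iᵀ Y^i V_i` with `∑ i, V_iᵀ V_i = I`. -/
def IsMatrixConvexCombination {g n l : ℕ} (X : MatTuple g n) (m : Fin l → ℕ)
    (Y : ∀ i, MatTuple g (m i)) (V : ∀ i, Matrix (Fin (m i)) (Fin n) ℝ) : Prop :=
  (∑ i, (V i).transpose * V i = 1) ∧
    ∀ j, X j = ∑ i, (V i).transpose * Y i j * V i

/-- The matrix convex hull: all finite matrix convex combinations of elements of `E`. -/
def matrixConvexHull {g : ℕ} (E : FreeSet g) : FreeSet g :=
  fun n => {X | ∃ (l : ℕ) (m : Fin l → ℕ) (Y : ∀ i, MatTuple g (m i))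
    (V : ∀ i, Matrix (Fin (m i)) (Fin n) ℝ),
    (∀ i, Y i ∈ E (m i)) ∧ IsMatrixConvexCombination X m Y V}

/-- The tuple of block matrices `(X β; βᵀ γ)`. -/
def blockTuple {g n k : ℕ} (X : MatTuple g n) (β : Fin g → Matrix (Fin n) (Fin k) ℝ)
    (γ : MatTuple g k) : MatTuple g (n + k) :=
  fun j => Matrix.reindex finSumFinEquiv finSumFinEquiv
    (Matrix.fromBlocks (X j) (β j) (β j).transpose (γ j))

/-- The direct sum `X ⊕ Z`. -/
def directSum {g n k : ℕ} (X : MatTuple g n) (Z : MatTuple g k) : MatTuple g (n + k) :=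
  blockTuple X 0 Z

/-- Unitary equivalence over `ℝ`: `Uᵀ X U = Y` for an orthogonal matrix `U`. Rows and columns
of `U` are indexed separately so that no cast between equal sizes is needed; the two
orthogonality conditions force the sizes to be equal. -/
def UnitarilyEquivalent {g n m : ℕ} (X : MatTuple g n) (Y : MatTuple g m) : Prop :=
  ∃ U : Matrix (Fin n) (Fin m) ℝ, U.transpose * U = 1 ∧ U * U.transpose = 1 ∧
    ∀ j, U.transpose * X j * U = Y j

/-- The set of free extreme points of `K`: those `X ∈ K` such that in every expression of `X` as
a matrix convex combination of elements `Y^i ∈ K` with all `V_i ≠ 0`, each `Y^i` either has the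
size of `X` and is unitarily equivalent to `X`, or is larger than `X` and is unitarily
equivalent to `X ⊕ Z` for some `Z ∈ K`. -/
def freeBoundary {g : ℕ} (K : FreeSet g) : FreeSet g :=
  fun n => {X | X ∈ K n ∧
    ∀ (l : ℕ) (m : Fin l → ℕ) (Y : ∀ i, MatTuple g (m i))
      (V : ∀ i, Matrix (Fin (m i)) (Fin n) ℝ),
      (∀ i, Y i ∈ K (m i)) → (∀ i, V i ≠ 0) → IsMatrixConvexCombination X m Y V →
      ∀ i, (m i = n ∧ UnitarilyEquivalent X (Y i)) ∨
        ∃ k : ℕ, 0 < k ∧ m i = n + k ∧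
          ∃ Z ∈ K k, UnitarilyEquivalent (directSum X Z) (Y i)}

/-- The Arveson boundary of `K`: those `X ∈ K` such that `(X β; βᵀ γ) ∈ K` implies `β = 0`. -/
def arvesonBoundary {g : ℕ} (K : FreeSet g) : FreeSet g :=
  fun n => {X | X ∈ K n ∧
    ∀ (k : ℕ) (β : Fin g → Matrix (Fin n) (Fin k) ℝ) (γ : MatTuple g k),
      blockTuple X β γ ∈ K (n + k) → β = 0}

/-- The first level of `K`, as a subset of `ℝ^g`. -/
def levelOne {g : ℕ} (K : FreeSet g) : Set (Fin g → ℝ) :=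
  {x | (fun j => Matrix.of fun _ _ => x j : MatTuple g 1) ∈ K 1}

end FreeSet

/-- A (bounded, convex, nondegenerate) quadrilateral in the plane: the convex hull of four
points none of which lies in the convex hull of the others. -/
def IsQuadrilateral (S : Set (Fin 2 → ℝ)) : Prop :=
  ∃ v : Fin 4 → Fin 2 → ℝ, ConvexIndependent ℝ v ∧ S = convexHull ℝ (Set.range v)

/-- A free quadrilateral: a free spectrahedron in two variables that is defined by a pair of
diagonal `4 × 4` matrices and whose first level is a bounded quadrilateral. -/
def IsFreeQuadrilateral (K : FreeSet 2) : Prop :=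
  IsQuadrilateral K.levelOne ∧
    ∃ A : MatTuple 2 4, (∀ j, (A j).IsDiag) ∧ K = FreeSet.freeSpectrahedron A

/-! A linear relation among the four affine functions that define the sides has two coefficients of
each sign: otherwise one side would be redundant, and three inequalities would cut out a
quadrilateral. So the sides can be ordered and scaled to satisfy `p₀ + p₂ = p₁ + p₃`. Boundedness
moreover gives positive weights with `∑ aᵢ pᵢ = 1` (`exists_isQuadFrame`).

At a matrix point `X` the sum `T = p₀(X) + p₂(X) = p₁(X) + p₃(X)` is positive definite. The
congruence that turns `T` into `1` turns the `pᵢ(X)` into `A, B, 1 - A, 1 - B` with `A, B` positive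
contractions. Halmos dilation makes `A` and `B` corners of projections, and two projections reduce
simultaneously to blocks of size at most two (`Matrix.PosSemidef.exists_pair_decomposition`).

Conversely, projections `E, F` of size two become, after the congruence that normalises `a₀ E + a₁ F
+ a₂ (1 - E) + a₃ (1 - F)` to `1`, the values `pᵢ(Y)` at an Arveson extreme point `Y`. Since `∑ aᵢ
pᵢ = 1` holds at every tuple, the accumulated congruences automatically form a matrix convex
combination. The size bound follows, because a free extreme point is unitarily equivalent to, or a
direct summand of, every tuple used in a combination for it. -/

/-! ### Plane geometry of a quadrilateral -/

/-- The value at `x` of the linear form on the plane with coefficients `b`. -/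
def planeForm (b x : Fin 2 → ℝ) : ℝ := b 0 * x 0 + b 1 * x 1

theorem planeForm_add_right (b x y : Fin 2 → ℝ) :
    planeForm b (x + y) = planeForm b x + planeForm b y := by
  simp only [planeForm, Pi.add_apply]; ring

theorem planeForm_smul_right (b x : Fin 2 → ℝ) (t : ℝ) :
    planeForm b (t • x) = t * planeForm b x := by
  simp only [planeForm, Pi.smul_apply, smul_eq_mul]; ring

/-- The polyhedron cut out by the inequalities `0 ≤ 1 + b i · x`. -/
def polyhedron {ι : Type*} (b : ι → Fin 2 → ℝ) : Set (Fin 2 → ℝ) :=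
  {x | ∀ i, 0 ≤ 1 + planeForm (b i) x}

/-- The polyhedron contains `0`, hence also the whole ray spanned by such a direction. -/
theorem eq_zero_of_recession {ι : Type*} {b : ι → Fin 2 → ℝ}
    (hb : Bornology.IsBounded (polyhedron b)) {d : Fin 2 → ℝ}
    (hd : ∀ i, 0 ≤ planeForm (b i) d) : d = 0 := by
  by_contra hne
  obtain ⟨R, hR⟩ := hb.exists_norm_le
  have hn : 0 < ‖d‖ := norm_pos_iff.2 hne
  have h0 : (0 : Fin 2 → ℝ) ∈ polyhedron b := fun i => by simp [planeForm]
  have hR0 : 0 ≤ R := (norm_nonneg _).trans (hR _ h0)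
  have hmem : ((R + 1) / ‖d‖) • d ∈ polyhedron b := fun i => by
    rw [planeForm_smul_right]
    have := mul_nonneg (div_nonneg (by linarith : 0 ≤ R + 1) hn.le) (hd i)
    linarith
  have := hR _ hmem
  rw [norm_smul, Real.norm_of_nonneg (div_nonneg (by linarith) hn.le),
    div_mul_cancel₀ _ hn.ne'] at this
  linarith

/-- Vertices are extreme: averaging the two memberships would put `v k` in the hull of the other
points, unless both put all their weight on `v k`. -/
theorem ConvexIndependent.eq_zero_of_add_mem_of_sub_mem {ι E : Type*} [AddCommGroup E] [Module ℝ E]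
    {v : ι → E} (hv : ConvexIndependent ℝ v) (k : ι) {d : E}
    (h1 : v k + d ∈ convexHull ℝ (Set.range v)) (h2 : v k - d ∈ convexHull ℝ (Set.range v)) :
    d = 0 := by
  have hnot := (convexIndependent_iff_notMem_convexHull_sdiff.1 hv) k Set.univ
  set R := v '' (Set.univ \ {k}) with hR
  have hrange : Set.range v = insert (v k) R := by
    rw [hR, ← Set.image_insert_eq, ← Set.image_univ]
    congr 1
    ext x
    simp
  rcases R.eq_empty_or_nonempty with h | h
  · rw [hrange, h] at h1
    simpa using h1
  rw [hrange, convexHull_insert h, mem_convexJoin] at h1 h2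
  obtain ⟨_, rfl, y, hy, s, s', hs, hs', hss, h1⟩ := h1
  obtain ⟨_, rfl, z, hz, t, t', ht, ht', htt, h2⟩ := h2
  obtain rfl : s = 1 - s' := by linarith
  obtain rfl : t = 1 - t' := by linarith
  have hsum : s' • y + t' • z = (s' + t') • v k := by
    have e : (1 - s') • v k + s' • y + ((1 - t') • v k + t' • z) = (v k + d) + (v k - d) := by
      rw [h1, h2]
    rw [← sub_eq_zero] at e ⊢
    rw [← e]
    module
  rcases (add_nonneg hs' ht').eq_or_lt with h0 | h0
  · have : s' = 0 := by linarith
    subst this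
    simpa using h1
  · refine absurd ?_ hnot
    have : v k = (s' / (s' + t')) • y + (t' / (s' + t')) • z := by
      have e : v k = (s' + t')⁻¹ • ((s' + t') • v k) := by
        rw [smul_smul, inv_mul_cancel₀ h0.ne', one_smul]
      rw [e, ← hsum, smul_add, smul_smul, smul_smul, div_eq_inv_mul, div_eq_inv_mul]
    rw [this]
    exact convex_convexHull ℝ _ hy hz (by positivity) (by positivity) (by field_simp)

theorem exists_ne_zero_planeForm_eq_zero (b : Fin 2 → ℝ) : ∃ d, d ≠ 0 ∧ planeForm b d = 0 := by
  by_cases h : b = 0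
  · exact ⟨1, one_ne_zero, by simp [h, planeForm]⟩
  · refine ⟨![-b 1, b 0], fun h' => h ?_, by simp [planeForm]; ring⟩
    have h0 := congrFun h' 0
    have h1 := congrFun h' 1
    ext i; fin_cases i <;> simp_all

theorem exists_ne_zero_of_det_eq_zero {b c : Fin 2 → ℝ} (h : b 0 * c 1 - b 1 * c 0 = 0) :
    ∃ d, d ≠ 0 ∧ planeForm b d = 0 ∧ planeForm c d = 0 := by
  by_cases hb : b = 0
  · obtain ⟨d, hd, hc⟩ := exists_ne_zero_planeForm_eq_zero c
    exact ⟨d, hd, by simp [hb, planeForm], hc⟩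
  · refine ⟨![-b 1, b 0], fun h' => hb ?_, by simp [planeForm]; ring, by
      simp [planeForm]; linarith⟩
    have h0 := congrFun h' 0
    have h1 := congrFun h' 1
    ext i; fin_cases i <;> simp_all

theorem eq_zero_of_planeForm_eq_zero {b c x : Fin 2 → ℝ} (h : b 0 * c 1 - b 1 * c 0 ≠ 0)
    (hb : planeForm b x = 0) (hc : planeForm c x = 0) : x = 0 := by
  simp only [planeForm] at hb hc
  have h0 : (b 0 * c 1 - b 1 * c 0) * x 0 = 0 := by linear_combination c 1 * hb - b 1 * hc
  have h1 : (b 0 * c 1 - b 1 * c 0) * x 1 = 0 := by linear_combination b 0 * hc - c 0 * hb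
  ext i
  fin_cases i
  · exact (mul_eq_zero.1 h0).resolve_left h
  · exact (mul_eq_zero.1 h1).resolve_left h

/-- If the directions along which finitely many strictly positive affine constraints move are
small enough, the constraints stay nonnegative. -/
theorem exists_pos_forall_abs_mul_le {ι : Type*} [Finite ι] (f g : ι → ℝ)
    (hf : ∀ i, 0 ≤ f i) (hg : ∀ i, f i = 0 → g i = 0) :
    ∃ e : ℝ, 0 < e ∧ ∀ i, |e * g i| ≤ f i := by
  have key : ∀ i, ∀ᶠ e in nhdsWithin (0 : ℝ) (Set.Ioi 0), |e * g i| ≤ f i := fun i => by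
    rcases (hf i).eq_or_lt with h | h
    · exact Filter.Eventually.of_forall fun e => by simp [hg i h.symm, ← h]
    · have : Filter.Tendsto (fun e : ℝ => |e * g i|) (nhdsWithin 0 (Set.Ioi 0)) (nhds 0) := by
        have : Continuous fun e : ℝ => |e * g i| := by fun_prop
        simpa using (this.tendsto 0).mono_left nhdsWithin_le_nhds
      exact (this.eventually_lt_const h).mono fun _ => le_of_lt
  obtain ⟨e, he, h⟩ := ((Filter.eventually_all.2 key).and
    (self_mem_nhdsWithin : Set.Ioi (0 : ℝ) ∈ nhdsWithin 0 (Set.Ioi 0))).exists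
  exact ⟨e, h, he⟩

/-- Three inequalities do not cut out a quadrilateral. -/
theorem polyhedron_three_ne_convexHull (b : Fin 3 → Fin 2 → ℝ) (v : Fin 4 → Fin 2 → ℝ)
    (hv : ConvexIndependent ℝ v) : polyhedron b ≠ convexHull ℝ (Set.range v) := by
  intro hS
  have hbd : Bornology.IsBounded (polyhedron b) := by
    rw [hS, isBounded_convexHull]
    exact (Set.finite_range v).isBounded
  have hmem : ∀ k i, 0 ≤ 1 + planeForm (b i) (v k) := fun k => by
    have : v k ∈ polyhedron b := hS ▸ subset_convexHull ℝ _ ⟨k, rfl⟩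
    exact this
  -- If two sides are parallel, some `d ≠ 0` annihilates both forms; the third has a sign on `d`, so
  -- `d` or `-d` is a recession direction.
  have hdet : ∀ i j : Fin 3, i ≠ j → b i 0 * b j 1 - b i 1 * b j 0 ≠ 0 := by
    intro i j hij h
    obtain ⟨d, hd, h1, h2⟩ := exists_ne_zero_of_det_eq_zero h
    obtain ⟨m, hm⟩ : ∃ m, ∀ k, k = i ∨ k = j ∨ k = m := by
      clear h h1 h2; revert i j; decide
    rcases le_total 0 (planeForm (b m) d) with h | h
    · refine hd (eq_zero_of_recession hbd fun k => ?_)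
      rcases hm k with rfl | rfl | rfl <;> simp [*]
    · have : (-1 : ℝ) • d = 0 := eq_zero_of_recession hbd fun k => by
        rw [planeForm_smul_right]
        rcases hm k with rfl | rfl | rfl <;> simp [*]
      simp [hd] at this
  -- At least two sides are active at each vertex: with two inactive, a short move either way along
  -- the third side's direction would stay inside.
  have hact : ∀ k, ∃ h, ∀ i ≠ h, 1 + planeForm (b i) (v k) = 0 := by
    intro k
    by_contra! hcon
    obtain ⟨i, -, hi⟩ := hcon 0
    obtain ⟨j, hji, hj⟩ := hcon i
    obtain ⟨m, hm⟩ : ∃ m, ∀ k, k = i ∨ k = j ∨ k = m := by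
      clear hi hj; revert i j; decide
    obtain ⟨d, hd, hmd⟩ := exists_ne_zero_planeForm_eq_zero (b m)
    obtain ⟨e, he, hle⟩ := exists_pos_forall_abs_mul_le (fun i => 1 + planeForm (b i) (v k))
      (fun i => planeForm (b i) d) (hmem k) (fun l hl => by
        rcases hm l with rfl | rfl | rfl
        · exact absurd hl hi
        · exact absurd hl hj
        · exact hmd)
    have : e • d = 0 := hv.eq_zero_of_add_mem_of_sub_mem k
      (by
        rw [← hS]
        intro i
        rw [planeForm_add_right, planeForm_smul_right]
        linarith [neg_le_of_abs_le (hle i)])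
      (by
        rw [← hS, sub_eq_add_neg, ← neg_smul]
        intro i
        rw [planeForm_add_right, planeForm_smul_right]
        linarith [le_of_abs_le (hle i)])
    simp [he.ne', hd] at this
  choose f hf using hact
  -- Four vertices and three choices of omitted side: two vertices lie on the same two sides, which
  -- meet in one point.
  obtain ⟨k, k', hkk, hff⟩ := Fintype.exists_ne_map_eq_of_card_lt f (by simp)
  obtain ⟨i, j, hij, hi, hj⟩ : ∃ i j, i ≠ j ∧ i ≠ f k ∧ j ≠ f k := by
    generalize f k = x; revert x; decide
  refine hkk (hv.injective (sub_eq_zero.1 (eq_zero_of_planeForm_eq_zero (hdet i j hij) ?_ ?_)))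
  · have h1 := hf k i hi
    have h2 := hf k' i (hff ▸ hi)
    rw [sub_eq_add_neg, ← neg_one_smul ℝ, planeForm_add_right, planeForm_smul_right]
    linarith
  · have h1 := hf k j hj
    have h2 := hf k' j (hff ▸ hj)
    rw [sub_eq_add_neg, ← neg_one_smul ℝ, planeForm_add_right, planeForm_smul_right]
    linarith

theorem exists_affine_relation (b : Fin 4 → Fin 2 → ℝ) :
    ∃ c : Fin 4 → ℝ, c ≠ 0 ∧ ∑ i, c i = 0 ∧ ∀ j, ∑ i, c i * b i j = 0 := by
  -- Three equations in four unknowns; the zero row makes the system square and singular.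
  let M : Matrix (Fin 4) (Fin 4) ℝ :=
    Matrix.of ![fun _ => 1, fun i => b i 0, fun i => b i 1, fun _ => 0]
  have hM : M.det = 0 := Matrix.det_eq_zero_of_row_eq_zero 3 fun j => rfl
  obtain ⟨c, hc, h⟩ := Matrix.exists_mulVec_eq_zero_iff.2 hM
  have h0 := congrFun h 0
  have h1 := congrFun h 1
  have h2 := congrFun h 2
  simp only [Matrix.mulVec, dotProduct, M, Matrix.of_apply, Fin.sum_univ_four, Pi.zero_apply,
    Matrix.cons_val_zero, Matrix.cons_val_one, Matrix.cons_val] at h0 h1 h2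
  refine ⟨c, hc, ?_, fun j => ?_⟩
  · rw [Fin.sum_univ_four]; linarith
  · rw [Fin.sum_univ_four]; fin_cases j
    · simp only [Fin.zero_eta]; linarith
    · simp only [Fin.mk_one]; linarith

/-- With a single negative coefficient, the relation exhibits that side's affine function as a
nonnegative combination of the other three. -/
theorem polyhedron_eq_of_redundant {b : Fin 4 → Fin 2 → ℝ} {c : Fin 4 → ℝ} (h0 : ∑ i, c i = 0)
    (hb : ∀ j, ∑ i, c i * b i j = 0) (h : Fin 4) (hneg : c h < 0)
    (hpos : ∀ i ≠ h, 0 ≤ c i) :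
    polyhedron b = polyhedron fun i => b (h.succAbove i) := by
  ext x
  refine ⟨fun hx i => hx _, fun hx => ?_⟩
  have hsum : ∑ i, c i * (1 + planeForm (b i) x) = 0 := by
    have e : ∀ i, c i * (1 + planeForm (b i) x) =
        c i + c i * b i 0 * x 0 + c i * b i 1 * x 1 := fun i => by simp only [planeForm]; ring
    simp only [e, Finset.sum_add_distrib, ← Finset.sum_mul, h0, hb]
    simp
  rw [Fin.sum_univ_succAbove _ h] at hsum
  have hnn : 0 ≤ ∑ i, c (h.succAbove i) * (1 + planeForm (b (h.succAbove i)) x) :=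
    Finset.sum_nonneg fun i _ => mul_nonneg (hpos _ (Fin.succAbove_ne h i)) (hx i)
  have hh : 0 ≤ 1 + planeForm (b h) x := by
    by_contra! hlt
    have := mul_pos_of_neg_of_neg hneg hlt
    linarith
  intro i
  rcases eq_or_ne i h with rfl | hi
  · exact hh
  · obtain ⟨k, rfl⟩ := Fin.exists_succAbove_eq hi
    exact hx k

/-- The four sides of a quadrilateral can be ordered so that suitable positive multiples of the
defining affine functions satisfy `p₀ + p₂ = p₁ + p₃`. -/
theorem exists_alternating_relation {b v : Fin 4 → Fin 2 → ℝ} (hv : ConvexIndependent ℝ v)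
    (hS : polyhedron b = convexHull ℝ (Set.range v)) :
    ∃ (σ : Equiv.Perm (Fin 4)) (c : Fin 4 → ℝ), (∀ i, 0 < c i) ∧ c 0 + c 2 = c 1 + c 3 ∧
      ∀ j, c 0 * b (σ 0) j + c 2 * b (σ 2) j = c 1 * b (σ 1) j + c 3 * b (σ 3) j := by
  obtain ⟨c, hc, h0, hb⟩ := exists_affine_relation b
  have two : ∀ c : Fin 4 → ℝ, c ≠ 0 → ∑ i, c i = 0 → (∀ j, ∑ i, c i * b i j = 0) →
      ∃ i j, i ≠ j ∧ c i < 0 ∧ c j < 0 := by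
    intro c hc h0 hb
    obtain ⟨i, hi⟩ : ∃ i, c i < 0 := by
      by_contra! hcon
      exact hc (funext fun i => (Finset.sum_eq_zero_iff_of_nonneg fun i _ => hcon i).1 h0 i
        (Finset.mem_univ i))
    by_contra! hcon
    exact polyhedron_three_ne_convexHull _ v hv
      ((polyhedron_eq_of_redundant h0 hb i hi fun j hj => hcon i j hj.symm hi).symm.trans hS)
  -- Used for `c` and for `-c`, so two coefficients are negative and two positive; the positive ones
  -- go to the even positions.
  obtain ⟨i, j, hij, hi, hj⟩ := two c hc h0 hb
  obtain ⟨k, l, hkl, hk, hl⟩ := two (-c) (neg_ne_zero.2 hc) (by simp [h0])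
    (fun j => by simp [hb])
  simp only [Pi.neg_apply, neg_lt_zero] at hk hl
  have hki : k ≠ i := by rintro rfl; linarith
  have hkj : k ≠ j := by rintro rfl; linarith
  have hli : l ≠ i := by rintro rfl; linarith
  have hlj : l ≠ j := by rintro rfl; linarith
  have hinj : Function.Injective ![k, i, l, j] := by
    clear hi hj hk hl
    intro x y hxy
    fin_cases x <;> fin_cases y <;> simp_all
  let σ : Equiv.Perm (Fin 4) := Equiv.ofBijective _ hinj.bijective_of_finite
  have hσ0 : σ 0 = k := rfl
  have hσ1 : σ 1 = i := rfl
  have hσ2 : σ 2 = l := rfl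
  have hσ3 : σ 3 = j := rfl
  have sum_eq : ∀ f : Fin 4 → ℝ, ∑ i, f i = f k + f i + f l + f j := fun f => by
    rw [← Equiv.sum_comp σ f, Fin.sum_univ_four, hσ0, hσ1, hσ2, hσ3]
  rw [sum_eq] at h0
  simp only [sum_eq] at hb
  refine ⟨σ, ![c k, -c i, c l, -c j], ?_, ?_, ?_⟩
  · intro m; fin_cases m <;> simp [*]
  · simp only [Matrix.cons_val]; linarith
  · intro m
    simp only [hσ0, hσ1, hσ2, hσ3, Matrix.cons_val]
    linarith [hb m]

theorem exists_planeForm_eq {p z : Fin 2 → ℝ} (h : p 0 * z 1 - p 1 * z 0 ≠ 0) (x y : ℝ) :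
    ∃ d, planeForm p d = x ∧ planeForm z d = y := by
  refine ⟨![(x * z 1 - y * p 1) / (p 0 * z 1 - p 1 * z 0),
    (y * p 0 - x * z 0) / (p 0 * z 1 - p 1 * z 0)], ?_, ?_⟩ <;>
  · simp only [planeForm, Matrix.cons_val]
    rw [← mul_div_assoc, ← mul_div_assoc, ← add_div, div_eq_iff h]
    ring

theorem exists_sign_mul_eq_abs (s : ℝ) : ∃ e : ℝ, |e| = 1 ∧ e * s = |s| := by
  rcases le_total 0 s with h | h
  · exact ⟨1, by simp, by simp [abs_of_nonneg h]⟩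
  · exact ⟨-1, by simp, by simp [abs_of_nonpos h]⟩

/-- If the polar cone of four vectors with `u₀ + u₂ = u₁ + u₃` is trivial, then `0` is a strictly
positive combination of them. -/
theorem exists_pos_relation_of_parallelogram {u : Fin 4 → Fin 2 → ℝ}
    (hu : ∀ j, u 0 j + u 2 j = u 1 j + u 3 j)
    (hrec : ∀ d, (∀ i, 0 ≤ planeForm (u i) d) → d = 0) :
    ∃ a : Fin 4 → ℝ, (∀ i, 0 < a i) ∧ ∀ j, ∑ i, a i * u i j = 0 := by
  -- Centre and half-diagonals of the parallelogram: its vertices are `m ± p` and `m ± z`.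
  set m : Fin 2 → ℝ := fun j => (u 0 j + u 2 j) / 2 with hm
  set p : Fin 2 → ℝ := fun j => (u 0 j - u 2 j) / 2 with hp
  set z : Fin 2 → ℝ := fun j => (u 1 j - u 3 j) / 2 with hz
  have e : ∀ d i, planeForm (u i) d = planeForm m d +
      (![planeForm p d, planeForm z d, -planeForm p d, -planeForm z d] : Fin 4 → ℝ) i := by
    intro d i
    fin_cases i <;> simp [planeForm, hm, hp, hz] <;> linarith [
      congrArg (· * d 0) (hu 0), congrArg (· * d 1) (hu 1)]
  have hdet : p 0 * z 1 - p 1 * z 0 ≠ 0 := by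
    intro h
    obtain ⟨d, hd, h1, h2⟩ := exists_ne_zero_of_det_eq_zero h
    rcases le_total 0 (planeForm m d) with h | h
    · refine hd (hrec d fun i => ?_)
      rw [e, h1, h2]; fin_cases i <;> simpa using h
    · have : (-1 : ℝ) • d = 0 := hrec _ fun i => by
        rw [planeForm_smul_right, e, h1, h2]; fin_cases i <;> simpa using h
      simp [hd] at this
  obtain ⟨s, t, hst⟩ : ∃ s t : ℝ, ∀ j, m j = -(s * p j) - t * z j := by
    obtain ⟨d, h0, h1⟩ := exists_planeForm_eq (p := ![p 0, z 0]) (z := ![p 1, z 1])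
      (by simp only [Matrix.cons_val]; convert hdet using 1; ring) (-m 0) (-m 1)
    simp only [planeForm, Matrix.cons_val] at h0 h1
    refine ⟨d 0, d 1, fun j => ?_⟩
    fin_cases j
    · simp only [Fin.zero_eta]; linarith
    · simp only [Fin.mk_one]; linarith
  -- Since `m + s p + t z = 0`, this places `0` inside the parallelogram. Otherwise the direction on
  -- which `p` and `z` take the values opposite to the signs of `s` and `t` is in the polar cone.
  have hlt : |s| + |t| < 1 := by
    by_contra! hge
    obtain ⟨e₁, he₁, hs⟩ := exists_sign_mul_eq_abs s
    obtain ⟨e₂, he₂, ht⟩ := exists_sign_mul_eq_abs t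
    obtain ⟨d, hd1, hd2⟩ := exists_planeForm_eq hdet (-e₁) (-e₂)
    have hmd : planeForm m d = |s| + |t| := by
      rw [← hs, ← ht]
      have : planeForm m d = -(s * planeForm p d) - t * planeForm z d := by
        simp only [planeForm, hst]; ring
      rw [this, hd1, hd2]; ring
    have h1 := abs_le.1 he₁.le
    have h2 := abs_le.1 he₂.le
    have : d = 0 := hrec d fun i => by
      rw [e, hmd, hd1, hd2]
      fin_cases i <;> simp <;> linarith [h1.1, h1.2, h2.1, h2.2]
    rw [this] at hd1
    simp only [planeForm, Pi.zero_apply, mul_zero, add_zero] at hd1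
    rw [← neg_eq_iff_eq_neg, neg_zero] at hd1
    simp [← hd1] at he₁
  have hs := abs_le.1 (le_refl |s|)
  have ht := abs_le.1 (le_refl |t|)
  -- The combination equals `2 (m + s p + t z) = 0`; all four weights are positive because `|s| +
  -- |t| < 1`.
  refine ⟨![(1 + |s| - |t|) / 2 + s, (1 - |s| + |t|) / 2 + t, (1 + |s| - |t|) / 2 - s,
    (1 - |s| + |t|) / 2 - t], ?_, fun j => ?_⟩
  · intro i
    fin_cases i <;> simp <;> linarith [hs.1, hs.2, ht.1, ht.2]
  · have h1 := hst j
    simp only [hm, hp, hz] at h1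
    simp only [Fin.sum_univ_four, Matrix.cons_val]
    linear_combination 2 * h1 + (-1 + |s| - |t|) / 2 * hu j

/-- Four affine functions `w i + u i · x` on the plane with `p₀ + p₂ = p₁ + p₃`, with
`p₀, p₁` linearly independent modulo constants, and with a positive combination equal
to `1`. -/
structure IsQuadFrame (w a : Fin 4 → ℝ) (u : Fin 4 → Fin 2 → ℝ) : Prop where
  const_rel : w 0 + w 2 = w 1 + w 3
  coeff_rel : ∀ j, u 0 j + u 2 j = u 1 j + u 3 j
  pos : ∀ i, 0 < a i
  sum_const : ∑ i, a i * w i = 1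
  sum_coeff : ∀ j, ∑ i, a i * u i j = 0
  det_ne_zero : u 0 0 * u 1 1 - u 0 1 * u 1 0 ≠ 0

theorem exists_isQuadFrame {b v : Fin 4 → Fin 2 → ℝ} (hv : ConvexIndependent ℝ v)
    (hS : polyhedron b = convexHull ℝ (Set.range v)) :
    ∃ (σ : Equiv.Perm (Fin 4)) (w a : Fin 4 → ℝ), (∀ i, 0 < w i) ∧
      IsQuadFrame w a fun i => w i • b (σ i) := by
  obtain ⟨σ, c, hc, hc0, hcb⟩ := exists_alternating_relation hv hS
  have hbd : Bornology.IsBounded (polyhedron b) := by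
    rw [hS, isBounded_convexHull]
    exact (Set.finite_range v).isBounded
  set u : Fin 4 → Fin 2 → ℝ := fun i => c i • b (σ i) with hu
  have hrel : ∀ j, u 0 j + u 2 j = u 1 j + u 3 j := hcb
  have huf : ∀ i d, planeForm (u i) d = c i * planeForm (b (σ i)) d := fun i d => by
    simp only [hu, planeForm, Pi.smul_apply, smul_eq_mul]; ring
  have hrec : ∀ d, (∀ i, 0 ≤ planeForm (u i) d) → d = 0 := fun d hd =>
    eq_zero_of_recession hbd fun i => by
      have := hd (σ.symm i)
      rw [huf, Equiv.apply_symm_apply] at this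
      exact nonneg_of_mul_nonneg_right this (hc _)
  obtain ⟨a, ha, hau⟩ := exists_pos_relation_of_parallelogram hrel hrec
  have hpos : 0 < ∑ i, a i * c i :=
    Finset.sum_pos (fun i _ => mul_pos (ha i) (hc i)) Finset.univ_nonempty
  -- The weights are divided by their total on the constant terms, so that the combination of affine
  -- functions is `1`.
  refine ⟨σ, c, fun i => a i / ∑ i, a i * c i, hc, hc0, hrel,
    fun i => div_pos (ha i) hpos, ?_, fun j => ?_, fun h => ?_⟩
  · simp only [div_mul_eq_mul_div, ← Finset.sum_div]
    exact div_self hpos.ne'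
  · simp only [div_mul_eq_mul_div, ← Finset.sum_div]
    exact (div_eq_zero_iff.2 (.inl (hau j)))
  · obtain ⟨d, hd, h0, h1⟩ := exists_ne_zero_of_det_eq_zero h
    have h23 : planeForm (u 2) d = planeForm (u 3) d := by
      simp only [planeForm] at h0 h1 ⊢
      linear_combination h1 - h0 + d 0 * hrel 0 + d 1 * hrel 1
    rcases le_total 0 (planeForm (u 2) d) with h | h
    · refine hd (hrec d fun i => ?_)
      fin_cases i
      exacts [h0.ge, h1.ge, h, h23 ▸ h]
    · have : (-1 : ℝ) • d = 0 := hrec _ fun i => by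
        rw [planeForm_smul_right]
        fin_cases i
        · exact (by rw [show planeForm (u 0) d = 0 from h0]; simp : 0 ≤ -1 * planeForm (u 0) d)
        · exact (by rw [show planeForm (u 1) d = 0 from h1]; simp : 0 ≤ -1 * planeForm (u 1) d)
        · exact (by linarith : 0 ≤ -1 * planeForm (u 2) d)
        · exact (by linarith : 0 ≤ -1 * planeForm (u 3) d)
      simp [hd] at this

/-! ### Reduction of two projections to blocks of size two -/

/-- Real orthogonal projections. -/
structure Matrix.IsOrthProj {ι : Type*} [Fintype ι] (E : Matrix ι ι ℝ) : Prop where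
  symm : E.transpose = E
  idem : E * E = E

namespace Matrix.IsOrthProj

variable {ι : Type*} [Fintype ι] {E : Matrix ι ι ℝ}

theorem one_sub [DecidableEq ι] (hE : E.IsOrthProj) : (1 - E).IsOrthProj where
  symm := by rw [Matrix.transpose_sub, Matrix.transpose_one, hE.symm]
  idem := by simp [Matrix.sub_mul, Matrix.mul_sub, hE.idem]

theorem posSemidef (hE : E.IsOrthProj) : E.PosSemidef := by
  have := Matrix.posSemidef_conjTranspose_mul_self E
  rwa [Matrix.conjTranspose_eq_transpose_of_trivial, hE.symm, hE.idem] at this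

theorem one [DecidableEq ι] : (1 : Matrix ι ι ℝ).IsOrthProj := ⟨by simp, by simp⟩

theorem mulVec_mulVec (hE : E.IsOrthProj) (v : ι → ℝ) : E.mulVec (E.mulVec v) = E.mulVec v := by
  rw [Matrix.mulVec_mulVec, hE.idem]

theorem eq_zero_of_trace_nonpos (hE : E.IsOrthProj) (h : E.trace ≤ 0) : E = 0 :=
  hE.posSemidef.trace_eq_zero_iff.1 (le_antisymm h hE.posSemidef.trace_nonneg)

end Matrix.IsOrthProj

/-- Puts invariance of the row span into the form of an intertwining relation, which also makes
sense for dependent rows. -/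
theorem Matrix.exists_mul_transpose_eq {ι : Type*} [Fintype ι] {E : Matrix ι ι ℝ}
    {V : Matrix (Fin 2) ι ℝ} (h : ∀ k, ∃ x y : ℝ, E.mulVec (V k) = x • V 0 + y • V 1) :
    ∃ N : Matrix (Fin 2) (Fin 2) ℝ, E * V.transpose = V.transpose * N := by
  choose x y h using h
  refine ⟨Matrix.of ![x, y], ?_⟩
  ext i k
  have := congrFun (h k) i
  simp only [Pi.add_apply, Pi.smul_apply, smul_eq_mul] at this
  rw [Matrix.mul_apply, Matrix.mul_apply, Fin.sum_univ_two]
  simp only [Matrix.transpose_apply, Matrix.of_apply, Matrix.cons_val]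
  rw [mul_comm (V 0 i), mul_comm (V 1 i), ← this]
  rfl

/-- Two projections admit an eigenvector of the first that generates, together with its image
under the second, an invariant subspace. -/
theorem Matrix.IsOrthProj.exists_generating_vector {ι : Type*} [Fintype ι]
    {E F Q : Matrix ι ι ℝ} (hE : E.IsOrthProj) (hF : F.IsOrthProj) (hQ : Q.IsOrthProj)
    (hQE : Q * E = E * Q) (hQF : Q * F = F * Q) (hQ0 : Q ≠ 0) :
    ∃ (v : ι → ℝ) (e x y : ℝ), v ≠ 0 ∧ Q.mulVec v = v ∧ E.mulVec v = e • v ∧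
      E.mulVec (F.mulVec v) = x • v + y • F.mulVec v := by
  classical
  -- The square of `E - F` commutes with both projections, so its eigenspaces are invariant under
  -- them.
  set C : Matrix ι ι ℝ := (E - F) * (E - F) with hC
  have hQC : Q * C = C * Q := by
    have : Q * (E - F) = (E - F) * Q := by rw [Matrix.mul_sub, Matrix.sub_mul, hQE, hQF]
    rw [hC, ← Matrix.mul_assoc, this, Matrix.mul_assoc, this, Matrix.mul_assoc]
  have hEC : E * C = C * E := by
    simp only [hC, Matrix.sub_mul, Matrix.mul_sub, Matrix.mul_assoc, hE.idem, hF.idem]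
    simp only [← Matrix.mul_assoc, hE.idem]
    abel
  have hsub : (E - F).transpose = E - F := by rw [Matrix.transpose_sub, hE.symm, hF.symm]
  have hCs : C.transpose = C := by rw [hC, Matrix.transpose_mul, hsub]
  -- Adding `1` makes the operator nonzero on the range of `Q`; an eigenvector with nonzero
  -- eigenvalue then lies in that range.
  have hNs : (Q * (1 + C)).IsHermitian := by
    rw [Matrix.IsHermitian, Matrix.conjTranspose_eq_transpose_of_trivial, Matrix.transpose_mul,
      hQ.symm, Matrix.transpose_add, hCs, Matrix.transpose_one, Matrix.mul_add, Matrix.add_mul,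
      hQC, Matrix.mul_one, Matrix.one_mul]
  have hN0 : Q * (1 + C) ≠ 0 := by
    intro h
    have h1 : Q + (Q * C) * Q = 0 := by
      have : Q * (1 + C) * Q = 0 := by rw [h, Matrix.zero_mul]
      rwa [Matrix.mul_add, Matrix.add_mul, Matrix.mul_one, hQ.idem] at this
    have h2 : ((Q * C) * Q).PosSemidef := by
      have := Matrix.posSemidef_conjTranspose_mul_self ((E - F) * Q)
      rwa [Matrix.conjTranspose_eq_transpose_of_trivial, Matrix.transpose_mul, hsub, hQ.symm,
        Matrix.mul_assoc, ← Matrix.mul_assoc (E - F), ← hC, ← Matrix.mul_assoc] at this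
    have h3 := congrArg Matrix.trace h1
    rw [Matrix.trace_add, Matrix.trace_zero] at h3
    have h4 := h2.trace_nonneg
    exact hQ0 (hQ.eq_zero_of_trace_nonpos (by linarith))
  obtain ⟨v, t, ht, hv, hvt⟩ := hNs.exists_eigenvector_of_ne_zero hN0
  have hQv : Q.mulVec v = v := by
    have h1 : t • Q.mulVec v = t • v := by
      rw [← hvt, ← Matrix.mulVec_smul, ← hvt, Matrix.mulVec_mulVec, ← Matrix.mul_assoc, hQ.idem]
    exact smul_right_injective _ ht h1
  have hCv : C.mulVec v = (t - 1) • v := by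
    have h1 : (1 + C).mulVec v = t • v := by
      rw [← hvt]
      conv_lhs => rw [← hQv]
      rw [Matrix.mulVec_mulVec, Matrix.mul_add, Matrix.add_mul, hQC]
      simp
    rw [Matrix.add_mulVec, Matrix.one_mulVec] at h1
    rw [sub_smul, one_smul, ← h1]; abel
  -- Expanding `C = E - E F - F E + F` on an eigenvector of both `C` and `E` solves for `E F v`.
  have main : ∀ (v : ι → ℝ) (e : ℝ), C.mulVec v = (t - 1) • v → E.mulVec v = e • v →
      E.mulVec (F.mulVec v) = (e - (t - 1)) • v + (1 - e) • F.mulVec v := by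
    intro v e h1 h2
    have h3 : C.mulVec v = E.mulVec v - F.mulVec (E.mulVec v) - E.mulVec (F.mulVec v)
        + F.mulVec v := by
      rw [hC, ← Matrix.mulVec_mulVec, Matrix.sub_mulVec, Matrix.sub_mulVec, Matrix.mulVec_sub,
        Matrix.mulVec_sub, hE.mulVec_mulVec, hF.mulVec_mulVec]
      abel
    rw [h1, h2, Matrix.mulVec_smul] at h3
    have h4 : E.mulVec (F.mulVec v) = e • v - e • F.mulVec v + F.mulVec v - (t - 1) • v := by
      rw [h3]; abel
    rw [h4]; module
  by_cases h : E.mulVec v = 0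
  · exact ⟨v, 0, _, _, hv, hQv, by rw [h, zero_smul], main v 0 hCv (by rw [h, zero_smul])⟩
  · have he : E.mulVec (E.mulVec v) = (1 : ℝ) • E.mulVec v := by rw [hE.mulVec_mulVec, one_smul]
    refine ⟨E.mulVec v, 1, _, _, h, ?_, he, main _ 1 ?_ he⟩
    · rw [Matrix.mulVec_mulVec, hQE, ← Matrix.mulVec_mulVec, hQv]
    · rw [Matrix.mulVec_mulVec, ← hEC, ← Matrix.mulVec_mulVec, hCv, Matrix.mulVec_smul]

/-- Two projections reduce a subspace of dimension one or two of every common reducing subspace;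
the subspace is given by a partial isometry onto it. -/
theorem Matrix.IsOrthProj.exists_partialIsometry {ι : Type*} [Fintype ι]
    {E F Q : Matrix ι ι ℝ} (hE : E.IsOrthProj) (hF : F.IsOrthProj) (hQ : Q.IsOrthProj)
    (hQE : Q * E = E * Q) (hQF : Q * F = F * Q) (hQ0 : Q ≠ 0) :
    ∃ V : Matrix (Fin 2) ι ℝ, V * V.transpose * V = V ∧ 1 ≤ (V.transpose * V).trace ∧
      Q * V.transpose = V.transpose ∧ (∃ N : Matrix (Fin 2) (Fin 2) ℝ, E * V.transpose = V.transpose * N) ∧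
      ∃ N : Matrix (Fin 2) (Fin 2) ℝ, F * V.transpose = V.transpose * N := by
  obtain ⟨v, e, x, y, hv, hQv, hEv, hEFv⟩ := hE.exists_generating_vector hF hQ hQE hQF hQ0
  have hvv : 0 < v ⬝ᵥ v :=
    lt_of_le_of_ne (Finset.sum_nonneg fun i _ => mul_self_nonneg (v i))
      (Ne.symm (by simpa [dotProduct_self_eq_zero] using hv))
  set c : ℝ := (Real.sqrt (v ⬝ᵥ v))⁻¹ with hc
  set p : ι → ℝ := c • v with hp
  have hpp : p ⬝ᵥ p = 1 := by
    rw [hp, smul_dotProduct, dotProduct_smul, smul_eq_mul, smul_eq_mul, ← mul_assoc, hc,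
      ← mul_inv, Real.mul_self_sqrt hvv.le, inv_mul_cancel₀ hvv.ne']
  have hQp : Q.mulVec p = p := by rw [hp, Matrix.mulVec_smul, hQv]
  have hEp : E.mulVec p = e • p := by rw [hp, Matrix.mulVec_smul, hEv, smul_comm]
  have hEFp : E.mulVec (F.mulVec p) = x • p + y • F.mulVec p := by
    rw [hp, Matrix.mulVec_smul, Matrix.mulVec_smul, hEFv]; module
  clear_value p
  set k : ℝ := p ⬝ᵥ F.mulVec p with hk
  set f : ι → ℝ := F.mulVec p - k • p with hf
  have hpf : p ⬝ᵥ f = 0 := by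
    rw [hf, dotProduct_sub, dotProduct_smul, hpp, ← hk]; simp
  set r : ℝ := Real.sqrt (f ⬝ᵥ f) with hr
  have hff : 0 ≤ f ⬝ᵥ f := Finset.sum_nonneg fun i _ => mul_self_nonneg (f i)
  -- If `f = 0` then `r⁻¹ = 0` and `q = 0`: a one-dimensional block is padded with a zero row.
  set q : ι → ℝ := r⁻¹ • f with hq
  have hpq : p ⬝ᵥ q = 0 := by rw [hq, dotProduct_smul, hpf, smul_zero]
  have hqp : q ⬝ᵥ p = 0 := by rw [dotProduct_comm, hpq]
  have hrq : r • q = f := by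
    rcases eq_or_ne r 0 with h | h
    · have : f = 0 := by
        rw [hr, Real.sqrt_eq_zero hff, dotProduct_self_eq_zero] at h; exact h
      rw [hq, this, smul_zero, smul_zero]
    · rw [hq, smul_smul, mul_inv_cancel₀ h, one_smul]
  have hqq : (q ⬝ᵥ q) • q = q := by
    rcases eq_or_ne r 0 with h | h
    · simp [hq, h]
    · have : q ⬝ᵥ q = 1 := by
        rw [hq, smul_dotProduct, dotProduct_smul, smul_eq_mul, smul_eq_mul, ← mul_assoc,
          ← Real.mul_self_sqrt hff, ← hr]
        field_simp
      rw [this, one_smul]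
  have hFp : F.mulVec p = k • p + r • q := by rw [hrq, hf]; abel
  have hEq : E.mulVec q = (r⁻¹ * (x + y * k - k * e)) • p + (r⁻¹ * (y * r)) • q := by
    rw [hq, Matrix.mulVec_smul, hf, Matrix.mulVec_sub, Matrix.mulVec_smul, hEFp, hEp, ← hf, ← hq,
      hFp]
    module
  have hFq : F.mulVec q = (r⁻¹ * (1 - k) * k) • p + (r⁻¹ * (1 - k) * r) • q := by
    rw [hq, Matrix.mulVec_smul, hf, Matrix.mulVec_sub, Matrix.mulVec_smul, hF.mulVec_mulVec,
      ← hf, ← hq, hFp]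
    module
  have hQq : Q.mulVec q = q := by
    rw [hq, Matrix.mulVec_smul, hf, Matrix.mulVec_sub, Matrix.mulVec_smul, Matrix.mulVec_mulVec,
      hQF, ← Matrix.mulVec_mulVec, hQp]
  set V : Matrix (Fin 2) ι ℝ := Matrix.of ![p, q] with hV
  have hV0 : V 0 = p := rfl
  have hV1 : V 1 = q := rfl
  have hG : ∀ i j, (V * V.transpose) i j = V i ⬝ᵥ V j := fun i j => rfl
  refine ⟨V, ?_, ?_, ?_, Matrix.exists_mul_transpose_eq fun i => ?_,
    Matrix.exists_mul_transpose_eq fun i => ?_⟩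
  · ext i j
    rw [Matrix.mul_apply, Fin.sum_univ_two, hG, hG]
    fin_cases i
    · simp [hV0, hV1, hpp, hpq]
    · simpa [hV0, hV1, hqp] using congrFun hqq j
  · rw [Matrix.trace_mul_comm, Matrix.trace_fin_two, hG, hG, hV0, hV1, hpp]
    have : 0 ≤ q ⬝ᵥ q := Finset.sum_nonneg fun i _ => mul_self_nonneg (q i)
    linarith
  · ext i j
    fin_cases j
    · exact congrFun hQp i
    · exact congrFun hQq i
  · fin_cases i
    · exact ⟨e, 0, by simpa [hV0, hV1] using hEp⟩
    · exact ⟨_, _, hEq⟩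
  · fin_cases i
    · exact ⟨_, _, hFp⟩
    · exact ⟨_, _, hFq⟩

section PartialIsometry

variable {ι κ : Type*} [Fintype ι] [Fintype κ] {E Q : Matrix ι ι ℝ} {V : Matrix κ ι ℝ}

theorem Matrix.isOrthProj_transpose_mul_self (hV : V * V.transpose * V = V) :
    (V.transpose * V).IsOrthProj where
  symm := by rw [Matrix.transpose_mul, Matrix.transpose_transpose]
  idem := by rw [Matrix.mul_assoc, ← Matrix.mul_assoc V, hV]

/-- An invariant subspace of a symmetric matrix is reducing; the proof transposes `P E P = E P` for
`P = Vᵀ V`. -/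
theorem Matrix.IsOrthProj.transpose_mul_self_comm (hE : E.IsOrthProj)
    (hV : V * V.transpose * V = V) (h : ∃ N : Matrix κ κ ℝ, E * V.transpose = V.transpose * N) :
    V.transpose * V * E = E * (V.transpose * V) := by
  obtain ⟨N, hN⟩ := h
  have hV' : V.transpose * V * V.transpose = V.transpose := by
    simpa [Matrix.transpose_mul, Matrix.mul_assoc] using congrArg Matrix.transpose hV
  have h1 : V.transpose * V * (E * (V.transpose * V)) = E * (V.transpose * V) := by
    rw [← Matrix.mul_assoc E, hN, Matrix.mul_assoc V.transpose N, ← Matrix.mul_assoc _ _ (N * V),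
      hV']
  have h2 := congrArg Matrix.transpose h1
  simp only [Matrix.transpose_mul, Matrix.transpose_transpose, hE.symm] at h2
  rw [← h2, ← Matrix.mul_assoc] at *
  simpa only [Matrix.mul_assoc] using h1

theorem Matrix.IsOrthProj.compress (hE : E.IsOrthProj) (hV : V * V.transpose * V = V)
    (h : V.transpose * V * E = E * (V.transpose * V)) : (V * E * V.transpose).IsOrthProj where
  symm := by simp [Matrix.transpose_mul, hE.symm, Matrix.mul_assoc]
  idem := by
    have : V * E * V.transpose * (V * E * V.transpose) =
        V * E * (V.transpose * V * E) * V.transpose := by simp only [Matrix.mul_assoc]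
    rw [this, h]
    have : V * E * (E * (V.transpose * V)) * V.transpose =
        V * (E * E * (V.transpose * V)) * V.transpose := by simp only [Matrix.mul_assoc]
    rw [this, hE.idem, ← h]
    have : V * (V.transpose * V * E) * V.transpose =
        V * V.transpose * V * E * V.transpose := by simp only [Matrix.mul_assoc]
    rw [this, hV]

theorem Matrix.transpose_mul_compress_mul (hV : V * V.transpose * V = V)
    (h : V.transpose * V * E = E * (V.transpose * V)) :
    V.transpose * (V * E * V.transpose) * V = E * (V.transpose * V) := by
  have : V.transpose * (V * E * V.transpose) * V = V.transpose * V * E * (V.transpose * V) := by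
    simp only [Matrix.mul_assoc]
  rw [this, h, Matrix.mul_assoc, (Matrix.isOrthProj_transpose_mul_self hV).idem]

end PartialIsometry

/-- Simultaneous reduction of two projections to blocks of size at most two. -/
theorem Matrix.IsOrthProj.exists_decomposition {ι : Type*} [Fintype ι]
    {E F : Matrix ι ι ℝ} (hE : E.IsOrthProj) (hF : F.IsOrthProj) :
    ∀ (t : ℕ) (Q : Matrix ι ι ℝ), Q.IsOrthProj → Q * E = E * Q → Q * F = F * Q →
      Q.trace ≤ t → ∃ (l : ℕ) (V : Fin l → Matrix (Fin 2) ι ℝ),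
        (∀ k, V k * (V k).transpose * V k = V k) ∧
        (∀ k, (V k).transpose * V k * E = E * ((V k).transpose * V k)) ∧
        (∀ k, (V k).transpose * V k * F = F * ((V k).transpose * V k)) ∧
        ∑ k, (V k).transpose * V k = Q := by
  intro t
  -- The trace of `Q` is its rank, and each split-off block lowers it by at least one.
  induction t with
  | zero =>
    intro Q hQ _ _ ht
    refine ⟨0, Fin.elim0, fun k => k.elim0, fun k => k.elim0, fun k => k.elim0, ?_⟩
    rw [hQ.eq_zero_of_trace_nonpos (by simpa using ht)]
    simp
  | succ t ih =>
    intro Q hQ hQE hQF ht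
    by_cases h0 : Q = 0
    · refine ⟨0, Fin.elim0, fun k => k.elim0, fun k => k.elim0, fun k => k.elim0, ?_⟩
      simp [h0]
    obtain ⟨V, hV, htr, hQV, hEV, hFV⟩ := hE.exists_partialIsometry hF hQ hQE hQF h0
    have cE := hE.transpose_mul_self_comm hV hEV
    have cF := hF.transpose_mul_self_comm hV hFV
    have hP := Matrix.isOrthProj_transpose_mul_self hV
    have hQP : Q * (V.transpose * V) = V.transpose * V := by rw [← Matrix.mul_assoc, hQV]
    have hPQ : V.transpose * V * Q = V.transpose * V := by
      have := congrArg Matrix.transpose hQP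
      rwa [Matrix.transpose_mul, hP.symm, hQ.symm] at this
    obtain ⟨l, W, h1, h2, h3, h4⟩ := ih (Q - V.transpose * V)
      ⟨by rw [Matrix.transpose_sub, hP.symm, hQ.symm],
        by simp [Matrix.sub_mul, Matrix.mul_sub, hQP, hPQ, hQ.idem, hP.idem]⟩
      (by rw [Matrix.sub_mul, Matrix.mul_sub, hQE, cE])
      (by rw [Matrix.sub_mul, Matrix.mul_sub, hQF, cF])
      (by rw [Matrix.trace_sub]; push_cast at ht; linarith)
    refine ⟨l + 1, Fin.cons V W, Fin.cases hV h1, Fin.cases cE h2, Fin.cases cF h3, ?_⟩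
    rw [Fin.sum_univ_succ]
    simp only [Fin.cons_zero, Fin.cons_succ]
    rw [h4]; abel

theorem Matrix.IsOrthProj.exists_blocks {ι : Type*} [Fintype ι] [DecidableEq ι]
    {E F : Matrix ι ι ℝ} (hE : E.IsOrthProj) (hF : F.IsOrthProj) :
    ∃ (l : ℕ) (V : Fin l → Matrix (Fin 2) ι ℝ) (e f : Fin l → Matrix (Fin 2) (Fin 2) ℝ),
      (∀ k, (e k).IsOrthProj) ∧ (∀ k, (f k).IsOrthProj) ∧
      ∑ k, (V k).transpose * V k = 1 ∧ ∑ k, (V k).transpose * e k * V k = E ∧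
      ∑ k, (V k).transpose * f k * V k = F := by
  obtain ⟨t, ht⟩ := exists_nat_ge (1 : Matrix ι ι ℝ).trace
  obtain ⟨l, V, h1, h2, h3, h4⟩ := hE.exists_decomposition hF t 1 .one (by simp) (by simp) ht
  refine ⟨l, V, fun k => V k * E * (V k).transpose, fun k => V k * F * (V k).transpose,
    fun k => hE.compress (h1 k) (h2 k), fun k => hF.compress (h1 k) (h3 k), h4, ?_, ?_⟩
  · rw [Finset.sum_congr rfl fun k _ => Matrix.transpose_mul_compress_mul (h1 k) (h2 k),
      ← Finset.mul_sum, h4, Matrix.mul_one]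
  · rw [Finset.sum_congr rfl fun k _ => Matrix.transpose_mul_compress_mul (h1 k) (h3 k),
      ← Finset.mul_sum, h4, Matrix.mul_one]

/-! ### Dilating positive contractions to projections -/

/-- Halmos dilation: a symmetric matrix with `0 ≤ A ≤ 1` is the corner of a projection. -/
theorem Matrix.exists_isOrthProj_fromBlocks {ι : Type*} [Fintype ι] [DecidableEq ι]
    {A : Matrix ι ι ℝ} (hA : A.PosSemidef) (hA1 : (1 - A).PosSemidef) :
    ∃ B C D : Matrix ι ι ℝ, (Matrix.fromBlocks A B C D).IsOrthProj := by
  obtain ⟨U, Λ, hU, hΛ⟩ : ∃ (U : Matrix ι ι ℝ) (Λ : ι → ℝ), U.transpose * U = 1 ∧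
      A = U * Matrix.diagonal Λ * U.transpose := by
    refine ⟨hA.1.eigenvectorUnitary, hA.1.eigenvalues, ?_, ?_⟩
    · exact (Unitary.mem_iff.1 hA.1.eigenvectorUnitary.2).1
    · conv_lhs => rw [hA.1.spectral_theorem]
      rfl
  have hconj : ∀ X : Matrix ι ι ℝ, X.PosSemidef → (U.transpose * X * U).PosSemidef := fun X hX => by
    simpa [Matrix.conjTranspose_eq_transpose_of_trivial] using hX.conjTranspose_mul_mul_same U
  have hd : U.transpose * A * U = Matrix.diagonal Λ := by
    have : U.transpose * A * U = U.transpose * U * Matrix.diagonal Λ * (U.transpose * U) := by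
      rw [hΛ]; simp only [Matrix.mul_assoc]
    rw [this, hU, Matrix.one_mul, Matrix.mul_one]
  have h0 : ∀ i, 0 ≤ Λ i := by
    have := hconj A hA
    rwa [hd, Matrix.posSemidef_diagonal_iff] at this
  have h1 : ∀ i, 0 ≤ 1 - Λ i := by
    have := hconj _ hA1
    rw [Matrix.mul_sub, Matrix.sub_mul, hd, Matrix.mul_one, hU, ← Matrix.diagonal_one,
      Matrix.diagonal_sub, Matrix.posSemidef_diagonal_iff] at this
    exact this
  -- The off-diagonal block `B` is the square root of `A (1 - A)`, formed in an eigenbasis of `A`;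
  -- the lower corner is `1 - A`.
  set s : ι → ℝ := fun i => Real.sqrt (Λ i * (1 - Λ i)) with hs
  have hss : ∀ i, s i * s i = Λ i * (1 - Λ i) := fun i =>
    Real.mul_self_sqrt (mul_nonneg (h0 i) (h1 i))
  set B := U * Matrix.diagonal s * U.transpose with hB
  have hmul : ∀ x y : ι → ℝ, U * Matrix.diagonal x * U.transpose *
      (U * Matrix.diagonal y * U.transpose) = U * Matrix.diagonal (x * y) * U.transpose := by
    intro x y
    have : U * Matrix.diagonal x * U.transpose * (U * Matrix.diagonal y * U.transpose) =
        U * (Matrix.diagonal x * (U.transpose * U) * Matrix.diagonal y) * U.transpose := by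
      simp only [Matrix.mul_assoc]
    rw [this, hU, Matrix.mul_one, Matrix.diagonal_mul_diagonal]
    rfl
  have hAB : A * B = B * A := by rw [hΛ, hB, hmul, hmul, mul_comm]
  have hBB : B * B = A - A * A := by
    rw [hΛ, hB, hmul, hmul, ← Matrix.sub_mul, ← Matrix.mul_sub, Matrix.diagonal_sub]
    congr 3
    ext i
    simp only [Pi.mul_apply, hss]; ring
  have hBs : B.transpose = B := by simp [hB, Matrix.transpose_mul, Matrix.mul_assoc]
  have hAs : A.transpose = A := by
    simpa [Matrix.conjTranspose_eq_transpose_of_trivial] using hA.1.eq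
  refine ⟨B, B, 1 - A, ?_, ?_⟩
  · rw [Matrix.fromBlocks_transpose, hBs, hAs, Matrix.transpose_sub, hAs, Matrix.transpose_one]
  · rw [Matrix.fromBlocks_multiply, hBB]
    congr 1 <;> simp [Matrix.mul_sub, Matrix.sub_mul, hAB]

/-- Two positive contractions are simultaneous compressions of pairs of projections of size
two. -/
theorem Matrix.PosSemidef.exists_pair_decomposition {ι : Type*} [Fintype ι] [DecidableEq ι]
    {A B : Matrix ι ι ℝ} (hA : A.PosSemidef) (hA1 : (1 - A).PosSemidef) (hB : B.PosSemidef)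
    (hB1 : (1 - B).PosSemidef) :
    ∃ (l : ℕ) (V : Fin l → Matrix (Fin 2) ι ℝ) (e f : Fin l → Matrix (Fin 2) (Fin 2) ℝ),
      (∀ k, (e k).IsOrthProj) ∧ (∀ k, (f k).IsOrthProj) ∧
      ∑ k, (V k).transpose * V k = 1 ∧ ∑ k, (V k).transpose * e k * V k = A ∧
      ∑ k, (V k).transpose * f k * V k = B := by
  obtain ⟨A₂, A₃, A₄, hE⟩ := Matrix.exists_isOrthProj_fromBlocks hA hA1
  obtain ⟨B₂, B₃, B₄, hF⟩ := Matrix.exists_isOrthProj_fromBlocks hB hB1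
  obtain ⟨l, V, e, f, he, hf, h1, h2, h3⟩ := hE.exists_blocks hF
  -- Keeping only the first block of columns of each `V k` compresses the sums to the corner.
  have corner : ∀ x : Fin l → Matrix (Fin 2) (Fin 2) ℝ,
      ∑ k, ((V k).submatrix id Sum.inl).transpose * x k * (V k).submatrix id Sum.inl =
        (∑ k, (V k).transpose * x k * V k).toBlocks₁₁ := by
    intro x
    ext i j
    simp only [Matrix.toBlocks₁₁, Matrix.of_apply, Matrix.sum_apply]
    rfl
  refine ⟨l, fun k => (V k).submatrix id Sum.inl, e, f, he, hf, ?_, ?_, ?_⟩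
  · have := corner fun _ => 1
    simp only [Matrix.mul_one] at this
    rw [this, h1, ← Matrix.fromBlocks_one, Matrix.toBlocks_fromBlocks₁₁]
  · rw [corner, h2, Matrix.toBlocks_fromBlocks₁₁]
  · rw [corner, h3, Matrix.toBlocks_fromBlocks₁₁]

/-! ### Factorisations of positive semidefinite matrices -/

open scoped MatrixOrder in
theorem Matrix.PosSemidef.exists_eq_transpose_mul_self {ι : Type*} [Fintype ι] [DecidableEq ι]
    {A : Matrix ι ι ℝ} (hA : A.PosSemidef) : ∃ B : Matrix ι ι ℝ, A = B.transpose * B := by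
  obtain ⟨B, hB⟩ := CStarAlgebra.nonneg_iff_eq_star_mul_self.mp hA.nonneg
  exact ⟨B, by rw [hB, Matrix.star_eq_conjTranspose,
    Matrix.conjTranspose_eq_transpose_of_trivial]⟩

theorem Matrix.PosDef.exists_invertible_factor {ι : Type*} [Fintype ι] [DecidableEq ι]
    {A : Matrix ι ι ℝ} (hA : A.PosDef) :
    ∃ S R : Matrix ι ι ℝ, A = S.transpose * S ∧ S * R = 1 ∧ R * S = 1 := by
  obtain ⟨S, hS⟩ := hA.posSemidef.exists_eq_transpose_mul_self
  have h : A⁻¹ * S.transpose * S = 1 := by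
    rw [Matrix.mul_assoc, ← hS,
      Matrix.nonsing_inv_mul _ ((Matrix.isUnit_iff_isUnit_det _).1 hA.isUnit)]
  exact ⟨S, A⁻¹ * S.transpose, hS, mul_eq_one_comm.1 h, h⟩

theorem Matrix.PosSemidef.transpose_mul_mul {m n : Type*} [Fintype n] [Fintype m]
    {A : Matrix n n ℝ} (hA : A.PosSemidef) (B : Matrix n m ℝ) :
    (B.transpose * A * B).PosSemidef := by
  simpa [Matrix.conjTranspose_eq_transpose_of_trivial] using hA.conjTranspose_mul_mul_same B

/-- In a Gram factorisation `RᵀR` with column blocks `R₁, R₂`, `A Z = 0` forces `R₁ Z = 0`, and `C =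
R₂ᵀ R₁`. -/
theorem Matrix.PosSemidef.offDiag_mul_eq_zero {m k l : Type*} [Fintype m] [Fintype k]
    [DecidableEq m] [DecidableEq k] {A : Matrix m m ℝ} {B : Matrix m k ℝ} {C : Matrix k m ℝ}
    {D : Matrix k k ℝ} (h : (Matrix.fromBlocks A B C D).PosSemidef) {Z : Matrix m l ℝ}
    (hZ : A * Z = 0) : C * Z = 0 := by
  obtain ⟨R, hR⟩ := h.exists_eq_transpose_mul_self
  set R₁ := R.submatrix id Sum.inl with hR₁
  set R₂ := R.submatrix id Sum.inr with hR₂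
  have hA : A = R₁.transpose * R₁ := by
    ext i j
    exact congrFun (congrFun hR (Sum.inl i)) (Sum.inl j)
  have hC : C = R₂.transpose * R₁ := by
    ext i j
    exact congrFun (congrFun hR (Sum.inr i)) (Sum.inl j)
  have : R₁ * Z = 0 := by
    rwa [hA, ← Matrix.conjTranspose_eq_transpose_of_trivial,
      Matrix.conjTranspose_mul_self_mul_eq_zero] at hZ
  rw [hC, Matrix.mul_assoc, this, Matrix.mul_zero]

theorem Matrix.posSemidef_blockDiagonal_iff {o m : Type*} [Fintype o] [Fintype m] [DecidableEq o]
    [DecidableEq m] {M : o → Matrix m m ℝ} :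
    (Matrix.blockDiagonal M).PosSemidef ↔ ∀ i, (M i).PosSemidef := by
  refine ⟨fun h i => ?_, fun h => ?_⟩
  · have := h.submatrix fun k => (k, i)
    convert this using 1
    ext k l
    simp
  · choose B hB using fun i => (h i).exists_eq_transpose_mul_self
    have := Matrix.posSemidef_conjTranspose_mul_self (Matrix.blockDiagonal B)
    rw [Matrix.conjTranspose_eq_transpose_of_trivial, Matrix.blockDiagonal_transpose,
      ← Matrix.blockDiagonal_mul] at this
    rwa [show M = fun i => (B i).transpose * B i from funext hB]

/-! ### Affine functions evaluated at matrix tuples -/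

/-- The value at `X` of the affine function `c + u · x`. -/
def affineEval {n : ℕ} (c : ℝ) (u : Fin 2 → ℝ) (X : MatTuple 2 n) : Matrix (Fin n) (Fin n) ℝ :=
  c • 1 + u 0 • X 0 + u 1 • X 1

/-- The dimension-free set of solutions of a family of affine inequalities. -/
def affineSystem {ι : Type*} (w : ι → ℝ) (u : ι → Fin 2 → ℝ) : FreeSet 2 :=
  fun _ => {X | (∀ j, (X j).IsSymm) ∧ ∀ i, (affineEval (w i) (u i) X).PosSemidef}

/-- After swapping the tensor factors, a pencil with diagonal coefficients is block diagonal, one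
block per inequality. -/
theorem freeSpectrahedron_eq_affineSystem {d : ℕ} {B : MatTuple 2 d} (hB : ∀ j, (B j).IsDiag) :
    FreeSet.freeSpectrahedron B = affineSystem (fun _ => 1) fun i j => B j i i := by
  funext n
  ext X
  simp only [FreeSet.freeSpectrahedron, affineSystem, Set.mem_ofPred_eq]
  refine and_congr_right fun _ => ?_
  have : FreeSet.monicPencil B X = (Matrix.blockDiagonal
      fun i => affineEval 1 (fun j => B j i i) X).submatrix Prod.swap Prod.swap := by
    ext ⟨i, k⟩ ⟨i', k'⟩
    simp only [FreeSet.monicPencil, Fin.sum_univ_two, affineEval, Matrix.add_apply,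
      Matrix.submatrix_apply, Prod.swap_prod_mk, Matrix.blockDiagonal_apply,
      Matrix.kroneckerMap_apply, Matrix.smul_apply, smul_eq_mul, Matrix.one_apply, Prod.mk.injEq,
      one_mul]
    by_cases h : i = i'
    · subst h; simp; ring
    · simp [h, hB 0 h, hB 1 h]
  rw [this, ← Matrix.posSemidef_blockDiagonal_iff]
  exact Matrix.posSemidef_submatrix_equiv (Equiv.prodComm (Fin d) (Fin n))

theorem levelOne_affineSystem {ι : Type*} (b : ι → Fin 2 → ℝ) :
    (affineSystem (fun _ => 1) b).levelOne = polyhedron b := by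
  ext x
  simp only [FreeSet.levelOne, affineSystem, polyhedron, Set.mem_ofPred_eq]
  have h : ∀ i, affineEval 1 (b i) (fun j => Matrix.of fun _ _ => x j : MatTuple 2 1) =
      Matrix.diagonal fun _ => 1 + planeForm (b i) x := by
    intro i
    ext k l
    obtain rfl := Subsingleton.elim k l
    simp [affineEval, planeForm]; ring
  simp only [h, Matrix.posSemidef_diagonal_iff]
  constructor
  · rintro ⟨-, h⟩ i
    exact h i 0
  · intro h
    exact ⟨fun j => by ext k l; rfl, fun i _ => h i⟩

theorem affineEval_smul {n : ℕ} (c t : ℝ) (u : Fin 2 → ℝ) (X : MatTuple 2 n) :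
    affineEval (t * c) (t • u) X = t • affineEval c u X := by
  simp only [affineEval, Pi.smul_apply, smul_eq_mul]; module

theorem affineSystem_eq_rescale {ι : Type*} (b : ι → Fin 2 → ℝ) (σ : Equiv.Perm ι) {w : ι → ℝ}
    (hw : ∀ i, 0 < w i) :
    affineSystem (fun _ => 1) b = affineSystem w fun i => w i • b (σ i) := by
  funext n
  ext X
  simp only [affineSystem, Set.mem_ofPred_eq]
  refine and_congr_right fun _ => ⟨fun h i => ?_, fun h i => ?_⟩
  · have := affineEval_smul 1 (w i) (b (σ i)) X
    rw [mul_one] at this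
    rw [this]
    exact (h _).smul (hw i).le
  · have := affineEval_smul (w (σ.symm i)) (w (σ.symm i))⁻¹ (w (σ.symm i) • b i) X
    rw [inv_mul_cancel₀ (hw _).ne', smul_smul, inv_mul_cancel₀ (hw _).ne', one_smul] at this
    rw [this]
    have h' := h (σ.symm i)
    rw [Equiv.apply_symm_apply] at h'
    exact h'.smul (inv_nonneg.2 (hw _).le)

theorem affineEval_convexCombination {n l : ℕ} {X : MatTuple 2 n} {m : Fin l → ℕ}
    {Y : ∀ i, MatTuple 2 (m i)} {V : ∀ i, Matrix (Fin (m i)) (Fin n) ℝ}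
    (h : FreeSet.IsMatrixConvexCombination X m Y V) (c : ℝ) (u : Fin 2 → ℝ) :
    affineEval c u X = ∑ i, (V i).transpose * affineEval c u (Y i) * V i := by
  simp only [affineEval, h.2, Matrix.mul_add, Matrix.add_mul, Finset.sum_add_distrib,
    Matrix.mul_smul, Matrix.smul_mul, ← Finset.smul_sum, Matrix.mul_one, h.1]

theorem affineSystem_mem_of_convexCombination {ι : Type*} {w : ι → ℝ} {u : ι → Fin 2 → ℝ}
    {n l : ℕ} {X : MatTuple 2 n} {m : Fin l → ℕ}
    {Y : ∀ i, MatTuple 2 (m i)} {V : ∀ i, Matrix (Fin (m i)) (Fin n) ℝ}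
    (h : FreeSet.IsMatrixConvexCombination X m Y V) (hY : ∀ i, Y i ∈ affineSystem w u (m i)) :
    X ∈ affineSystem w u n := by
  refine ⟨fun j => ?_, fun i => ?_⟩
  · rw [Matrix.IsSymm, h.2, Matrix.transpose_sum]
    refine Finset.sum_congr rfl fun i _ => ?_
    rw [Matrix.transpose_mul, Matrix.transpose_mul, Matrix.transpose_transpose, (hY i).1 j,
      Matrix.mul_assoc]
  · rw [affineEval_convexCombination h]
    exact Matrix.posSemidef_sum _ fun k _ => ((hY k).2 i).transpose_mul_mul _

namespace IsQuadFrame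

variable {w a : Fin 4 → ℝ} {u : Fin 4 → Fin 2 → ℝ} {n : ℕ}

theorem affineEval_rel (h : IsQuadFrame w a u) (X : MatTuple 2 n) :
    affineEval (w 0) (u 0) X + affineEval (w 2) (u 2) X =
      affineEval (w 1) (u 1) X + affineEval (w 3) (u 3) X := by
  ext r s
  simp only [affineEval, Matrix.add_apply, Matrix.smul_apply, smul_eq_mul]
  linear_combination (1 : Matrix (Fin n) (Fin n) ℝ) r s * h.const_rel + X 0 r s * h.coeff_rel 0 +
    X 1 r s * h.coeff_rel 1

theorem sum_smul_affineEval (h : IsQuadFrame w a u) (X : MatTuple 2 n) :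
    ∑ i, a i • affineEval (w i) (u i) X = 1 := by
  have h0 := h.sum_const
  have h1 := h.sum_coeff 0
  have h2 := h.sum_coeff 1
  rw [Fin.sum_univ_four] at *
  ext r s
  simp only [affineEval, Matrix.add_apply, Matrix.smul_apply, smul_eq_mul]
  linear_combination (1 : Matrix (Fin n) (Fin n) ℝ) r s * h0 + X 0 r s * h1 + X 1 r s * h2

/-- Cramer's rule, over a general module so that it serves both square tuples and rectangular
off-diagonal blocks. -/
theorem eq_zero_of_smul_add_smul_eq_zero (h : IsQuadFrame w a u) {M : Type*} [AddCommGroup M]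
    [Module ℝ M] {β : Fin 2 → M} (h0 : u 0 0 • β 0 + u 0 1 • β 1 = 0)
    (h1 : u 1 0 • β 0 + u 1 1 • β 1 = 0) : β = 0 := by
  have e0 : (u 0 0 * u 1 1 - u 0 1 * u 1 0) • β 0 = 0 := by
    have : (u 0 0 * u 1 1 - u 0 1 * u 1 0) • β 0 =
        u 1 1 • (u 0 0 • β 0 + u 0 1 • β 1) - u 0 1 • (u 1 0 • β 0 + u 1 1 • β 1) := by module
    rw [this, h0, h1]; simp
  have e1 : (u 0 0 * u 1 1 - u 0 1 * u 1 0) • β 1 = 0 := by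
    have : (u 0 0 * u 1 1 - u 0 1 * u 1 0) • β 1 =
        u 0 0 • (u 1 0 • β 0 + u 1 1 • β 1) - u 1 0 • (u 0 0 • β 0 + u 0 1 • β 1) := by module
    rw [this, h0, h1]; simp
  ext j
  fin_cases j
  · exact (smul_eq_zero.1 e0).resolve_left h.det_ne_zero
  · exact (smul_eq_zero.1 e1).resolve_left h.det_ne_zero

theorem ext_affineEval (h : IsQuadFrame w a u) {X Y : MatTuple 2 n}
    (hXY : ∀ i, affineEval (w i) (u i) X = affineEval (w i) (u i) Y) : X = Y := by
  rw [← sub_eq_zero]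
  refine h.eq_zero_of_smul_add_smul_eq_zero ?_ ?_
  · rw [← sub_eq_zero.2 (hXY 0)]
    simp only [affineEval, Pi.sub_apply]; module
  · rw [← sub_eq_zero.2 (hXY 1)]
    simp only [affineEval, Pi.sub_apply]; module

/-- Cramer's rule solves for `X` from `Q 0` and `Q 1`. The two relations then determine the other
two values, because `a 2 + a 3 ≠ 0`. -/
theorem exists_affineEval_eq (h : IsQuadFrame w a u) (Q : Fin 4 → Matrix (Fin n) (Fin n) ℝ)
    (hQs : ∀ i, (Q i).IsSymm) (hrel : Q 0 + Q 2 = Q 1 + Q 3) (hsum : ∑ i, a i • Q i = 1) :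
    ∃ X : MatTuple 2 n, (∀ j, (X j).IsSymm) ∧ ∀ i, affineEval (w i) (u i) X = Q i := by
  set D := u 0 0 * u 1 1 - u 0 1 * u 1 0 with hD
  have hD0 : D ≠ 0 := h.det_ne_zero
  let R : Fin 4 → Matrix (Fin n) (Fin n) ℝ := fun i => Q i - w i • 1
  have hR : ∀ i, (R i).IsSymm := fun i =>
    (hQs i).sub (Matrix.isSymm_one.smul _)
  let X : MatTuple 2 n := ![D⁻¹ • (u 1 1 • R 0 - u 0 1 • R 1), D⁻¹ • (u 0 0 • R 1 - u 1 0 • R 0)]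
  have e0 : affineEval (w 0) (u 0) X = Q 0 := by
    have : affineEval (w 0) (u 0) X = w 0 • 1 + (D⁻¹ * D) • R 0 := by
      simp only [affineEval, X, Matrix.cons_val, hD]; module
    rw [this, inv_mul_cancel₀ hD0, one_smul]
    simp only [R]; abel
  have e1 : affineEval (w 1) (u 1) X = Q 1 := by
    have : affineEval (w 1) (u 1) X = w 1 • 1 + (D⁻¹ * D) • R 1 := by
      simp only [affineEval, X, Matrix.cons_val, hD]; module
    rw [this, inv_mul_cancel₀ hD0, one_smul]
    simp only [R]; abel
  have r1 := h.affineEval_rel X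
  have r2 := h.sum_smul_affineEval X
  rw [Fin.sum_univ_four] at r2 hsum
  rw [e0, e1] at r1 r2
  have h3 : affineEval (w 3) (u 3) X - Q 3 = affineEval (w 2) (u 2) X - Q 2 := by
    rw [sub_eq_sub_iff_add_eq_add]
    have e3 : affineEval (w 3) (u 3) X = Q 0 + affineEval (w 2) (u 2) X - Q 1 := by
      rw [r1]; abel
    have e4 : Q 3 = Q 0 + Q 2 - Q 1 := by rw [hrel]; abel
    rw [e3, e4]; abel
  have h2 : (a 2 + a 3) • (affineEval (w 2) (u 2) X - Q 2) = 0 := by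
    have : (a 2 + a 3) • (affineEval (w 2) (u 2) X - Q 2) =
        a 2 • (affineEval (w 2) (u 2) X - Q 2) + a 3 • (affineEval (w 3) (u 3) X - Q 3) := by
      rw [h3]; module
    rw [this, ← sub_eq_zero.2 (r2.trans hsum.symm)]; module
  have h2' := (smul_eq_zero.1 h2).resolve_left (add_pos (h.pos 2) (h.pos 3)).ne'
  refine ⟨X, fun j => ?_, fun i => ?_⟩
  · fin_cases j
    · exact (((hR 0).smul _).sub ((hR 1).smul _)).smul _
    · exact (((hR 1).smul _).sub ((hR 0).smul _)).smul _
  · fin_cases i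
    exacts [e0, e1, sub_eq_zero.1 h2', sub_eq_zero.1 (h3.trans h2')]

end IsQuadFrame

/-! ### Arveson extreme points from pairs of projections -/

/-- The four projections `E, F, 1 - E, 1 - F`. -/
def projQuad {ι : Type*} [DecidableEq ι] (E F : Matrix ι ι ℝ) : Fin 4 → Matrix ι ι ℝ :=
  ![E, F, 1 - E, 1 - F]

section ProjQuad

variable {ι : Type*} [Fintype ι] [DecidableEq ι] {E F : Matrix ι ι ℝ}

theorem isOrthProj_projQuad (hE : E.IsOrthProj) (hF : F.IsOrthProj) (i : Fin 4) :
    (projQuad E F i).IsOrthProj := by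
  fin_cases i
  exacts [hE, hF, hE.one_sub, hF.one_sub]

theorem posDef_sum_smul_projQuad (hE : E.IsOrthProj) (hF : F.IsOrthProj) {a : Fin 4 → ℝ}
    (ha : ∀ i, 0 < a i) : (∑ i, a i • projQuad E F i).PosDef := by
  have hm : 0 < min (a 0) (a 2) := lt_min (ha 0) (ha 2)
  -- The terms in `E` and `1 - E` already dominate `min (a 0) (a 2)` times the identity.
  have : ∑ i, a i • projQuad E F i = min (a 0) (a 2) • (1 : Matrix ι ι ℝ) +
      ((a 0 - min (a 0) (a 2)) • E + (a 2 - min (a 0) (a 2)) • (1 - E) +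
        (a 1 • F + a 3 • (1 - F))) := by
    rw [Fin.sum_univ_four]
    simp only [projQuad, Matrix.cons_val]; module
  rw [this]
  refine (Matrix.PosDef.one.smul hm).add_posSemidef (((hE.posSemidef.smul ?_).add
    (hE.one_sub.posSemidef.smul ?_)).add ((hF.posSemidef.smul (ha 1).le).add
      (hF.one_sub.posSemidef.smul (ha 3).le)))
  · exact sub_nonneg.2 (min_le_left _ _)
  · exact sub_nonneg.2 (min_le_right _ _)

end ProjQuad

namespace IsQuadFrame

variable {w a : Fin 4 → ℝ} {u : Fin 4 → Fin 2 → ℝ} {n : ℕ}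

/-- A tuple whose four defining affine functions are simultaneously congruent to the projections
`E, F, 1 - E, 1 - F` is an Arveson extreme point. -/
theorem mem_arvesonBoundary (h : IsQuadFrame w a u) {X : MatTuple 2 n}
    {E F G : Matrix (Fin n) (Fin n) ℝ} (hE : E.IsOrthProj) (hF : F.IsOrthProj)
    (hX : X ∈ affineSystem w u n)
    (hG : ∀ i, affineEval (w i) (u i) X = G.transpose * projQuad E F i * G) :
    X ∈ (affineSystem w u).arvesonBoundary n := by
  refine ⟨hX, fun k β γ hblock => ?_⟩
  set P := projQuad E F with hP
  set M := ∑ i, a i • P i with hM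
  have hGM : G.transpose * M * G = 1 := by
    rw [← h.sum_smul_affineEval X, hM, Matrix.mul_sum, Matrix.sum_mul]
    refine Finset.sum_congr rfl fun i _ => ?_
    rw [hG, Matrix.mul_smul, Matrix.smul_mul]
  set K := G.transpose * M with hK
  have hGK : G * K = 1 := mul_eq_one_comm.1 hGM
  set b : Fin 4 → Matrix (Fin n) (Fin k) ℝ := fun i => u i 0 • β 0 + u i 1 • β 1 with hb
  set δ : Fin 4 → Matrix (Fin n) (Fin k) ℝ := fun i => K.transpose * b i with hδ
  have hbδ : ∀ i, b i = G.transpose * δ i := fun i => by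
    rw [hδ, ← Matrix.mul_assoc, ← Matrix.transpose_mul, hGM, Matrix.transpose_one, Matrix.one_mul]
  have hproj := isOrthProj_projQuad hE hF
  -- Positivity of the block matrix forces the columns of `b i` into the range of `Gᵀ P i G`; in the
  -- coordinates `δ` this is the range of `P i`.
  have hPδ : ∀ i, P i * δ i = δ i := by
    intro i
    have hps := (hblock.2 i).submatrix finSumFinEquiv
    have hblk : (affineEval (w i) (u i) (FreeSet.blockTuple X β γ)).submatrix finSumFinEquiv
        finSumFinEquiv = Matrix.fromBlocks (affineEval (w i) (u i) X) (b i) (b i).transpose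
          (affineEval (w i) (u i) γ) := by
      ext r s
      rcases r with r | r <;> rcases s with s | s <;>
        simp [affineEval, FreeSet.blockTuple, hb, Matrix.one_apply, Fin.ext_iff]
      · intro hrs; have := r.isLt; omega
      · intro hrs; have := s.isLt; omega
    rw [hblk] at hps
    have hz : affineEval (w i) (u i) X * (K * (1 - P i)) = 0 := by
      have : affineEval (w i) (u i) X * (K * (1 - P i)) =
          G.transpose * (P i * ((G * K) * (1 - P i))) := by
        rw [hG]; simp only [Matrix.mul_assoc]
      rw [this, hGK, Matrix.one_mul, Matrix.mul_sub, (hproj i).idem, Matrix.mul_one, sub_self,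
        Matrix.mul_zero]
    have h0 := congrArg Matrix.transpose (hps.offDiag_mul_eq_zero hz)
    rw [Matrix.transpose_mul, Matrix.transpose_mul, Matrix.transpose_transpose,
      (hproj i).one_sub.symm, Matrix.mul_assoc, Matrix.transpose_zero, Matrix.sub_mul,
      Matrix.one_mul, sub_eq_zero] at h0
    exact h0.symm
  have hrelb : b 0 + b 2 = b 1 + b 3 := by
    have e : ∀ i j, b i + b j = (u i 0 + u j 0) • β 0 + (u i 1 + u j 1) • β 1 := fun i j => by
      simp only [hb]; module
    rw [e, e, h.coeff_rel, h.coeff_rel]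
  have hrel : δ 0 + δ 2 = δ 1 + δ 3 := by
    simp only [hδ, ← Matrix.mul_add, hrelb]
  set t := δ 0 + δ 2 with ht
  have cross : ∀ {A B : Matrix (Fin n) (Fin n) ℝ} {x y : Matrix (Fin n) (Fin k) ℝ},
      A.IsOrthProj → B = 1 - A → A * x = x → B * y = y → A * (x + y) = x ∧ B * (x + y) = y := by
    rintro A _ x y hA rfl hx hy
    have hy' : A * y = 0 := by
      rw [← hy, ← Matrix.mul_assoc, Matrix.mul_sub, hA.idem]; simp
    have hx' : (1 - A) * x = 0 := by rw [Matrix.sub_mul, hx]; simp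
    exact ⟨by rw [Matrix.mul_add, hx, hy', add_zero], by rw [Matrix.mul_add, hx', hy, zero_add]⟩
  have h02 := cross hE rfl (hPδ 0) (hPδ 2)
  have h13 := cross hF rfl (hPδ 1) (hPδ 3)
  rw [← hrel] at h13
  -- Complementary projections recover both summands from `t`, so all four `δ i` are governed by one
  -- matrix.
  have hPt : ∀ i, P i * t = δ i := by
    intro i
    fin_cases i
    exacts [h02.1, h13.1, h02.2, h13.2]
  -- The coefficients satisfy `∑ aᵢ uᵢ = 0`, hence `∑ aᵢ bᵢ = 0`; as `M` is invertible, `t`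
  -- vanishes.
  have hMt : M * t = 0 := by
    have e : ∑ i, a i • b i = 0 := by
      have : ∑ i, a i • b i = (∑ i, a i * u i 0) • β 0 + (∑ i, a i * u i 1) • β 1 := by
        rw [Finset.sum_smul, Finset.sum_smul, ← Finset.sum_add_distrib]
        refine Finset.sum_congr rfl fun i _ => ?_
        simp only [hb]; module
      rw [this, h.sum_coeff, h.sum_coeff, zero_smul, zero_smul, add_zero]
    have : M * t = K.transpose * ∑ i, a i • b i := by
      rw [hM, Matrix.sum_mul, Matrix.mul_sum]
      refine Finset.sum_congr rfl fun i _ => ?_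
      rw [Matrix.smul_mul, hPt, Matrix.mul_smul]
    rw [this, e, Matrix.mul_zero]
  have ht0 : t = 0 := by
    have : t = G * G.transpose * (M * t) := by
      rw [← Matrix.mul_assoc, Matrix.mul_assoc G, ← hK, hGK, Matrix.one_mul]
    rw [this, hMt, Matrix.mul_zero]
  have hb0 : ∀ i, b i = 0 := fun i => by
    rw [hbδ, ← hPt, ht0, Matrix.mul_zero, Matrix.mul_zero]
  exact h.eq_zero_of_smul_add_smul_eq_zero (hb0 0) (hb0 1)

/-- Every pair of projections gives rise to an Arveson extreme point. -/
theorem exists_arveson_of_isOrthProj (h : IsQuadFrame w a u) {E F : Matrix (Fin n) (Fin n) ℝ}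
    (hE : E.IsOrthProj) (hF : F.IsOrthProj) :
    ∃ (X : MatTuple 2 n) (H : Matrix (Fin n) (Fin n) ℝ),
      X ∈ (affineSystem w u).arvesonBoundary n ∧
      ∀ i, H.transpose * affineEval (w i) (u i) X * H = projQuad E F i := by
  obtain ⟨H, G, hM, hHG, hGH⟩ := (posDef_sum_smul_projQuad hE hF h.pos).exists_invertible_factor
  have hproj := isOrthProj_projQuad hE hF
  have hGHt : H.transpose * G.transpose = 1 := by
    rw [← Matrix.transpose_mul, hGH, Matrix.transpose_one]
  have hHGt : G.transpose * H.transpose = 1 := mul_eq_one_comm.1 hGHt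
  obtain ⟨X, hXs, hX⟩ := h.exists_affineEval_eq
    (fun i => G.transpose * projQuad E F i * G)
    (fun i => by
      rw [Matrix.IsSymm, Matrix.transpose_mul, Matrix.transpose_mul, Matrix.transpose_transpose,
        (hproj i).symm, Matrix.mul_assoc])
    (by
      simp only [projQuad, Matrix.cons_val, ← Matrix.mul_add, ← Matrix.add_mul]
      rw [add_sub_cancel, add_sub_cancel])
    (by
      simp only [← Matrix.smul_mul _ _ G, ← Matrix.mul_smul]
      rw [← Matrix.sum_mul, ← Matrix.mul_sum, hM, ← Matrix.mul_assoc, hHGt, Matrix.one_mul, hHG])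
  have hmem : X ∈ affineSystem w u n :=
    ⟨hXs, fun i => by rw [hX]; exact (hproj i).posSemidef.transpose_mul_mul G⟩
  refine ⟨X, H, h.mem_arvesonBoundary hE hF hmem hX, fun i => ?_⟩
  rw [hX]
  have : H.transpose * (G.transpose * projQuad E F i * G) * H =
      (H.transpose * G.transpose) * projQuad E F i * (G * H) := by simp only [Matrix.mul_assoc]
  rw [this, hGHt, hGH, Matrix.one_mul, Matrix.mul_one]

/-! ### The matrix convex hull -/

/-- Adding the terms with weights exchanged inside each opposite pair to `∑ aᵢ pᵢ(X) = 1` shows that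
`(∑ aᵢ) (p₀(X) + p₂(X))` is `1` plus a positive semidefinite matrix. -/
theorem affineEval_add_posDef (h : IsQuadFrame w a u) {X : MatTuple 2 n}
    (hX : X ∈ affineSystem w u n) :
    (affineEval (w 0) (u 0) X + affineEval (w 2) (u 2) X).PosDef := by
  have hc : 0 < a 0 + a 2 + (a 1 + a 3) :=
    add_pos (add_pos (h.pos 0) (h.pos 2)) (add_pos (h.pos 1) (h.pos 3))
  have hsum := h.sum_smul_affineEval X
  rw [Fin.sum_univ_four] at hsum
  set P : Fin 4 → Matrix (Fin n) (Fin n) ℝ := fun i => affineEval (w i) (u i) X with hP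
  have hrel : P 0 + P 2 = P 1 + P 3 := h.affineEval_rel X
  have key : P 0 + P 2 = (a 0 + a 2 + (a 1 + a 3))⁻¹ •
      (1 + ((a 2 • P 0 + a 0 • P 2) + (a 3 • P 1 + a 1 • P 3))) := by
    rw [eq_inv_smul_iff₀ hc.ne', ← hsum, add_smul]
    nth_rewrite 2 [hrel]
    module
  change (P 0 + P 2).PosDef
  rw [key]
  have hs : ∀ i j, (a i • P j).PosSemidef := fun i j => (hX.2 j).smul (h.pos i).le
  exact (Matrix.PosDef.one.add_posSemidef
    (((hs _ _).add (hs _ _)).add ((hs _ _).add (hs _ _)))).smul (inv_pos.2 hc)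

theorem mem_matrixConvexHull_arvesonBoundary (h : IsQuadFrame w a u) {X : MatTuple 2 n}
    (hX : X ∈ affineSystem w u n) :
    X ∈ ((affineSystem w u).arvesonBoundary.atLevel 2).matrixConvexHull n := by
  obtain ⟨S, R, hT, hSR, hRS⟩ := (h.affineEval_add_posDef hX).exists_invertible_factor
  have hT' := (h.affineEval_rel X).symm.trans hT
  have hSRt : R.transpose * S.transpose = 1 := by
    rw [← Matrix.transpose_mul, hSR, Matrix.transpose_one]
  have hRSt : S.transpose * R.transpose = 1 := mul_eq_one_comm.1 hSRt
  have hone : R.transpose * (S.transpose * S) * R = 1 := by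
    rw [← Matrix.mul_assoc, hSRt, Matrix.one_mul, hSR]
  have hpos : ∀ i, (R.transpose * affineEval (w i) (u i) X * R).PosSemidef := fun i =>
    (hX.2 i).transpose_mul_mul R
  have h2 : 1 - R.transpose * affineEval (w 0) (u 0) X * R =
      R.transpose * affineEval (w 2) (u 2) X * R := by
    rw [← hone, ← hT, ← Matrix.sub_mul, ← Matrix.mul_sub, add_sub_cancel_left]
  have h3 : 1 - R.transpose * affineEval (w 1) (u 1) X * R =
      R.transpose * affineEval (w 3) (u 3) X * R := by
    rw [← hone, ← hT', ← Matrix.sub_mul, ← Matrix.mul_sub, add_sub_cancel_left]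
  obtain ⟨l, V, e, f, he, hf, hV, hVe, hVf⟩ :=
    (hpos 0).exists_pair_decomposition (h2 ▸ hpos 2) (hpos 1) (h3 ▸ hpos 3)
  have hVP : ∀ i, ∑ k, (V k).transpose * projQuad (e k) (f k) i * V k =
      R.transpose * affineEval (w i) (u i) X * R := by
    intro i
    fin_cases i
    · exact hVe
    · exact hVf
    · simp only [projQuad, Fin.reduceFinMk, Matrix.cons_val, Matrix.mul_sub, Matrix.sub_mul,
        Matrix.mul_one, Finset.sum_sub_distrib, hV, hVe, h2]
    · simp only [projQuad, Fin.reduceFinMk, Matrix.cons_val, Matrix.mul_sub, Matrix.sub_mul,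
        Matrix.mul_one, Finset.sum_sub_distrib, hV, hVf, h3]
  choose Y H hY hH using fun k => h.exists_arveson_of_isOrthProj (he k) (hf k)
  -- `S` undoes the normalisation of `X`, `V k` selects a block, and `H k` passes from the
  -- projections to the extreme point `Y k`.
  have hcomb : ∀ i, ∑ k, (H k * V k * S).transpose * affineEval (w i) (u i) (Y k) *
      (H k * V k * S) = affineEval (w i) (u i) X := by
    intro i
    have h1 : ∀ k, (H k * V k * S).transpose * affineEval (w i) (u i) (Y k) * (H k * V k * S) =
        S.transpose * ((V k).transpose * projQuad (e k) (f k) i * V k) * S := fun k => by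
      rw [← hH]; simp only [Matrix.transpose_mul, Matrix.mul_assoc]
    rw [Finset.sum_congr rfl fun k _ => h1 k, ← Matrix.sum_mul, ← Matrix.mul_sum, hVP]
    have : S.transpose * (R.transpose * affineEval (w i) (u i) X * R) * S =
        (S.transpose * R.transpose) * affineEval (w i) (u i) X * (R * S) := by
      simp only [Matrix.mul_assoc]
    rw [this, hRSt, hRS, Matrix.one_mul, Matrix.mul_one]
  -- Taking the `a`-weighted sum of `hcomb` gives the normalisation, as `∑ aᵢ pᵢ` is `1` at `X` and
  -- at every `Y k`.
  have hsum : ∑ k, (H k * V k * S).transpose * (H k * V k * S) = 1 := by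
    rw [← h.sum_smul_affineEval X, ← Finset.sum_congr rfl fun i _ => congrArg (a i • ·) (hcomb i)]
    simp only [Finset.smul_sum]
    rw [Finset.sum_comm]
    refine Finset.sum_congr rfl fun k _ => ?_
    simp only [← Matrix.smul_mul _ _ (H k * V k * S), ← Matrix.mul_smul]
    rw [← Matrix.sum_mul, ← Matrix.mul_sum, h.sum_smul_affineEval, Matrix.mul_one]
  have hconv : FreeSet.IsMatrixConvexCombination
      (fun j => ∑ k, (H k * V k * S).transpose * Y k j * (H k * V k * S)) (fun _ => 2) Y
      fun k => H k * V k * S := ⟨hsum, fun _ => rfl⟩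
  refine ⟨l, fun _ => 2, Y, fun k => H k * V k * S, fun k => ⟨rfl, hY k⟩, ?_⟩
  rwa [← h.ext_affineEval fun i => (affineEval_convexCombination hconv _ _).trans (hcomb i)]

theorem affineSystem_eq_matrixConvexHull (h : IsQuadFrame w a u) :
    affineSystem w u =
      ((affineSystem w u).arvesonBoundary.atLevel 2).matrixConvexHull := by
  funext n
  refine Set.Subset.antisymm (fun X hX => h.mem_matrixConvexHull_arvesonBoundary hX) ?_
  rintro X ⟨l, m, Y, V, hY, hX⟩
  exact affineSystem_mem_of_convexCombination hX fun i => (hY i).2.1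

end IsQuadFrame

/-! ### Free extreme points and the conclusion -/

theorem IsFreeQuadrilateral.exists_isQuadFrame {K : FreeSet 2} (hK : IsFreeQuadrilateral K) :
    ∃ (w a : Fin 4 → ℝ) (u : Fin 4 → Fin 2 → ℝ), IsQuadFrame w a u ∧ K = affineSystem w u := by
  obtain ⟨⟨v, hv, hS⟩, B, hB, rfl⟩ := hK
  rw [freeSpectrahedron_eq_affineSystem hB] at hS ⊢
  rw [levelOne_affineSystem] at hS
  obtain ⟨σ, w, a, hw, h⟩ := _root_.exists_isQuadFrame hv hS
  exact ⟨w, a, _, h, affineSystem_eq_rescale _ σ hw⟩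

/-- In a set that is generated by its elements of size `m`, the free extreme points have size at
most `m`. -/
theorem FreeSet.le_of_mem_freeBoundary {g m : ℕ} {K E : FreeSet g} (hEK : ∀ n, E n ⊆ K n)
    (hK : ∀ n, K n ⊆ (E.atLevel m).matrixConvexHull n) {n : ℕ} {X : MatTuple g n}
    (hX : X ∈ K.freeBoundary n) : n ≤ m := by
  classical
  obtain ⟨l, k, Y, V, hY, hV⟩ := hK n hX.1
  rcases Nat.eq_zero_or_pos n with rfl | hn
  · exact Nat.zero_le m
  -- The definition of a free extreme point tests only combinations with nonzero coefficients, so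
  -- vanishing terms are discarded; for `n > 0` some term remains.
  let e := (Fintype.equivFin {i // V i ≠ 0}).symm
  have hsum : ∀ Z : ∀ i, Matrix (Fin (k i)) (Fin (k i)) ℝ,
      ∑ i, (V (e i)).transpose * Z (e i) * V (e i) = ∑ i, (V i).transpose * Z i * V i := by
    intro Z
    refine Fintype.sum_of_injective (fun i => (e i : Fin l))
      (Subtype.val_injective.comp e.injective) _ _ (fun i hi => ?_) fun _ => rfl
    have : V i = 0 := by
      by_contra h
      exact hi ⟨e.symm ⟨i, h⟩, by simp⟩
    simp [this]
  have hone : ∑ i, (V (e i)).transpose * V (e i) = 1 := by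
    have := hsum fun _ => 1
    simp only [Matrix.mul_one] at this
    rw [this, hV.1]
  have hcomb : IsMatrixConvexCombination X (fun i => k (e i)) (fun i => Y (e i))
      fun i => V (e i) :=
    ⟨hone, fun j => by rw [hV.2 j, hsum fun i => Y i j]⟩
  rcases isEmpty_or_nonempty (Fin (Fintype.card {i // V i ≠ 0})) with hem | ⟨⟨i⟩⟩
  · rw [Finset.univ_eq_empty, Finset.sum_empty] at hone
    have := congrFun (congrFun hone ⟨0, hn⟩) ⟨0, hn⟩
    simp at this
  · have hm : k (e i) = m := (hY (e i)).1
    rcases hX.2 _ _ _ _ (fun i => hEK _ (hY (e i)).2) (fun i => (e i).2) hcomb i with h | h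
    · exact (h.1.symm.trans hm).le
    · obtain ⟨r, -, h, -⟩ := h
      omega

theorem proposition4p2 {d : ℕ} (A : MatTuple 2 d) (hA : ∀ j, (A j).IsSymm)
    (hQ : IsFreeQuadrilateral (FreeSet.freeSpectrahedron A)) :
    (∀ (n : ℕ) (X : MatTuple 2 n),
      X ∈ (FreeSet.freeSpectrahedron A).freeBoundary n → n ≤ 2) ∧
    FreeSet.freeSpectrahedron A =
      ((FreeSet.freeSpectrahedron A).arvesonBoundary.atLevel 2).matrixConvexHull := by
  obtain ⟨w, a, u, h, hK⟩ := hQ.exists_isQuadFrame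
  have hull := h.affineSystem_eq_matrixConvexHull
  rw [← hK] at hull
  exact ⟨fun n X hX => FreeSet.le_of_mem_freeBoundary (fun n X hX => hX.1)
    (fun n => (congrFun hull n).subset) hX, hull⟩
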